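/- **Setting.** Let $\Omega\subset\mathbb R^N$ be a bounded Lipschitz domain, $n\in\mathbb N$; repeated indices $\alpha,\beta=1,\dots,n$ and $i,j=1,\dots,N$ are summed. Let $a^{\alpha\beta}_{ij}(\varepsilon,\cdot)\in L^\infty(\Omega)$ ($\varepsilon>0$) be bounded uniformly in $\varepsilon$ and satisfy, for some $c>0$, the Legendre condition $a^{\alpha\beta}_{ij}(\varepsilon,x)v^\alpha_iv^\beta_j\ge c\,v^\alpha_iv^\alpha_i$ for all $\varepsilon>0$, almost all $x\in\Omega$ and all $v\in\mathbb R^{nN}$. Write $W:=W^{1,2}_0(\Omega;\mathbb R^n)$, $W^*:=W^{-1,2}(\Omega;\mathbb R^n)$ for its dual, and $C:=C(\overline\Omega;\mathbb R^n)$ with $\|u\|_\infty=\sum_\alpha\sup|u^\alpha|$. Define $A_\varepsilon:W\to W^*$ and $D$ by $$\langle A_\varepsilon u,\varphi\rangle=\int_\Omega a^{\alpha\beta}_{ij}(\varepsilon,x)\,\partial_{x_j}u^\beta\,\partial_{x_i}\varphi^\alpha\,dx,\qquad \langle Dg,\varphi\rangle=\int_\Omega g^\alpha_i\,\partial_{x_i}\varphi^\alpha\,dx\qquad(\varphi\in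 W),$$ and $\hat A$ in the same way from $\hat a^{\alpha\beta}_{ij}\in L^\infty(\Omega)$. Suppose that $a(\varepsilon,\cdot)$ H-converges to $\hat a$ for $\varepsilon\to0$: for every $\phi\in W^*$ and the corresponding solutions of $A_\varepsilon u_\varepsilon=\hat A\hat u=\phi$, one has $u_\varepsilon\rightharpoonup\hat u$ weakly in $W$ and $a^{\alpha\beta}_{ij}(\varepsilon,\cdot)\partial_{x_j}u^\beta_\varepsilon\rightharpoonup\hat a^{\alpha\beta}_{ij}\partial_{x_j}\hat u^\beta$ weakly in $L^2(\Omega)$. Let $p_0>N$, $p_0\ge2$, and let $f^\alpha_i:\Omega\times\mathbb R^n\to\mathbb R$ be such that $F(u):=[f^\alpha_i(\cdot,u(\cdot))]$ defines a $C^1$-map $F:C\to L^{p_0}(\Omega;\mathbb R^{nN})$. Let $u_0\in W\cap C$ satisfy $\hat Au_0+DF(u_0)=0$, and let $u=0$ be the only $u\in W\cap C$ with $\hat Au+DF'(u_0)u=0$. Let $U,V$ be real Banach spaces such that $U$ is continuously embedded into $W$ and compactly into $C$, and $V$ is continuously embedded into $W^*$. Suppose that $\hat A$ and $A_\varepsilon$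 ($\varepsilon>0$) map $U$ boundedly into $V$, that $D$ maps $L^{p_0}(\Omega;\mathbb R^{nN})$ boundedly into $V$, that each $A_\varepsilon:U\to V$ is bijective, and that $\sup_{\varepsilon>0}\|A_\varepsilon^{-1}\|_{\mathcal L(V;U)}<\infty$. Put $\bar u_\varepsilon:=-A_\varepsilon^{-1}DF(u_0)\in U$. **Theorem.** There is $\varepsilon_0>0$ such that $A_\varepsilon+DF'(u_0):U\to V$ is bijective for all $\varepsilon\in(0,\varepsilon_0]$, with inverses bounded in $\mathcal L(V;U)$ uniformly in $\varepsilon$. For these $\varepsilon$ let $$G_\varepsilon:U\to U,\qquad G_\varepsilon(u):=u-(A_\varepsilon+DF'(u_0))^{-1}(A_\varepsilon u+DF(u)).$$ There exist $r_0>0$ and $\varepsilon_1\in(0,\varepsilon_0]$ such that for all $\varepsilon\in(0,\varepsilon_1]$ the map $G_\varepsilon$ has exactly one fixed point $u_\varepsilon$ in the ball $\{u\in U:\|u-\bar u_\varepsilon\|_U\le r_0\}$. Moreover, $$\|u_\varepsilon-u_0\|_\infty=O\big(\|\bar u_\varepsilon-u_0\|_\infty+\|A_\varepsilon\bar u_\varepsilon+DF(\bar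 u_\varepsilon)\|_V\big)\quad\text{for }\varepsilon\to0.$$ Finally, there exist $\delta>0$ and $\varepsilon_2\in(0,\varepsilon_1]$ such that for all $\varepsilon\in(0,\varepsilon_2]$ the function $u_\varepsilon$ is the only fixed point $u\in U$ of $G_\varepsilon$ with $\|u-u_0\|_\infty<\delta$, and also the only $u\in W\cap C$ with $A_\varepsilon u+DF(u)=0$ and $\|u-u_0\|_\infty<\delta$. -/

import Mathlib

open MeasureTheory Filter Topology Set
open scoped ENNReal ContDiff BoundedContinuousFunction

noncomputable section

namespace Homog

/-! ### Function spaces -/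

/-- The space `ℝ^N` with its Euclidean norm. -/
abbrev Sp (N : ℕ) : Type := EuclideanSpace ℝ (Fin N)

/-- The space `ℝ^{nN}`; a vector `g` has the components `g (α, i)`, `α ≤ n`, `i ≤ N`. -/
abbrev Gr (n N : ℕ) : Type := EuclideanSpace ℝ (Fin n × Fin N)

/-- `Ω` is a bounded Lipschitz domain: open, connected, bounded, and near each of its boundary
points it is, for some unit vector `e`, the set of points `y` lying above the graph of a Lipschitz
function of the components of `y` orthogonal to `e`. -/
structure IsBoundedLipschitzDomain {N : ℕ} (Ω : Set (Sp N)) : Prop where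
  isOpen : IsOpen Ω
  isConnected : IsConnected Ω
  isBounded : Bornology.IsBounded Ω
  lipschitz : ∀ x ∈ frontier Ω, ∃ (e : Sp N) (g : Sp N → ℝ) (K : NNReal) (r : ℝ),
    ‖e‖ = 1 ∧ LipschitzWith K g ∧ (∀ (y : Sp N) (t : ℝ), g (y + t • e) = g y) ∧ 0 < r ∧
      ∀ y ∈ Metric.ball x r, (y ∈ Ω ↔ g y < inner ℝ y e)

/-- The Lebesgue space `L^p(Ω; ℝ^n)`. -/
abbrev LpVec {N : ℕ} (Ω : Set (Sp N)) (n : ℕ) (p : ℝ≥0∞) : Type :=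
  Lp (Sp n) p (volume.restrict Ω)

/-- The Lebesgue space `L^p(Ω; ℝ^{nN})`. -/
abbrev LpGr {N : ℕ} (Ω : Set (Sp N)) (n : ℕ) (p : ℝ≥0∞) : Type :=
  Lp (Gr n N) p (volume.restrict Ω)

/-- The Jacobian of a map `ψ : ℝ^N → ℝ^n`, as an element of `ℝ^{nN}`:
its components are `∂_{x_i} ψ^α (x)`. -/
def jac {n N : ℕ} (ψ : Sp N → Sp n) (x : Sp N) : Gr n N :=
  WithLp.toLp 2 fun k => fderiv ℝ ψ x (EuclideanSpace.single k.2 1) k.1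

/-- The pairs `(ψ, ∇ψ)`, `ψ` a smooth map with compact support in `Ω`, as elements of
`L^2(Ω; ℝ^n) × L^2(Ω; ℝ^{nN})` with the norm `(‖u‖^2 + ‖g‖^2)^{1/2}`. -/
def testPairs {N : ℕ} (Ω : Set (Sp N)) (n : ℕ) :
    Submodule ℝ (WithLp 2 (LpVec Ω n 2 × LpGr Ω n 2)) where
  carrier := {z | ∃ ψ : Sp N → Sp n, ContDiff ℝ ∞ ψ ∧ HasCompactSupport ψ ∧ tsupport ψ ⊆ Ω ∧
    z.fst =ᵐ[volume.restrict Ω] ψ ∧ z.snd =ᵐ[volume.restrict Ω] jac ψ}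
  zero_mem' := by
    refine ⟨0, contDiff_const, HasCompactSupport.zero, by simp [tsupport], ?_, ?_⟩
    · exact Lp.coeFn_zero _ _ _
    · refine (Lp.coeFn_zero _ _ _).trans (Eventually.of_forall fun x => ?_)
      ext k
      simp [jac]
  add_mem' := by
    rintro z w ⟨ψ, h1, h2, h3, h4, h5⟩ ⟨χ, k1, k2, k3, k4, k5⟩
    refine ⟨ψ + χ, h1.add k1, h2.add k2,
      (tsupport_add ψ χ).trans (union_subset h3 k3), ?_, ?_⟩
    · exact (Lp.coeFn_add _ _).trans (h4.add k4)
    · refine (Lp.coeFn_add _ _).trans ((h5.add k5).trans (Eventually.of_forall fun x => ?_))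
      ext k
      have := fderiv_add (h1.differentiable (by simp) x) (k1.differentiable (by simp) x)
      simp [jac, this]
  smul_mem' := by
    rintro c z ⟨ψ, h1, h2, h3, h4, h5⟩
    refine ⟨c • ψ, contDiff_const.smul h1, h2.mono' ?_, (closure_mono ?_).trans h3, ?_, ?_⟩
    · exact (Function.support_const_smul_subset c ψ).trans subset_closure
    · exact Function.support_const_smul_subset c ψ
    · exact (Lp.coeFn_smul _ _).trans (h4.const_smul c)
    · refine (Lp.coeFn_smul _ _).trans
        ((h5.const_smul c).trans (Eventually.of_forall fun x => ?_))
      ext k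
      have := fderiv_const_smul (h1.differentiable (by simp) x) c
      simp [jac, this]

/-- The Sobolev space `W_0^{1,2}(Ω; ℝ^n)`: the closure of the smooth maps with compact support in
`Ω` with respect to the norm of `W^{1,2}(Ω; ℝ^n)`. An element is recorded as the pair
`(u, ∇u) ∈ L^2 × L^2` of a function and its weak gradient. -/
abbrev W012 {N : ℕ} (Ω : Set (Sp N)) (n : ℕ) : Type :=
  ↥(testPairs Ω n).topologicalClosure

/-- The space `W^{-1,2}(Ω; ℝ^n)`: the dual of `W_0^{1,2}(Ω; ℝ^n)` with the dual norm. -/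
abbrev Wneg {N : ℕ} (Ω : Set (Sp N)) (n : ℕ) : Type := StrongDual ℝ (W012 Ω n)

/-- The function belonging to an element of `W_0^{1,2}(Ω; ℝ^n)`. -/
def W012.fn {N n : ℕ} {Ω : Set (Sp N)} (u : W012 Ω n) : LpVec Ω n 2 := u.1.fst

/-- The weak gradient, as a bounded linear map `W_0^{1,2}(Ω; ℝ^n) → L^2(Ω; ℝ^{nN})`. -/
def grad {N : ℕ} (Ω : Set (Sp N)) (n : ℕ) : W012 Ω n →L[ℝ] LpGr Ω n 2 :=
  (WithLp.sndL 2 ℝ (LpVec Ω n 2) (LpGr Ω n 2)) ∘L (testPairs Ω n).topologicalClosure.subtypeL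

/-- The space `C(closure Ω; ℝ^n)` with the maximum norm (for bounded `Ω` all continuous functions
on `closure Ω` are bounded). -/
abbrev CBar {N : ℕ} (Ω : Set (Sp N)) (n : ℕ) : Type := ↥(closure Ω) →ᵇ Sp n

/-- The function on `ℝ^N` that agrees with `v` on `closure Ω` and vanishes elsewhere. -/
def ext0 {N n : ℕ} {Ω : Set (Sp N)} (v : CBar Ω n) : Sp N → Sp n :=
  Function.extend Subtype.val v 0

/-- The norm `‖v‖_∞ = ∑_α sup |v^α|` of a function `v ∈ C(closure Ω; ℝ^n)`. -/
def supNorm {N n : ℕ} {Ω : Set (Sp N)} (v : CBar Ω n) : ℝ :=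
  ∑ α : Fin n, ⨆ x : ↥(closure Ω), |v x α|

theorem ext0_apply {N n : ℕ} {Ω : Set (Sp N)} (v : CBar Ω n) (x : ↥(closure Ω)) :
    ext0 v x = v x :=
  Subtype.val_injective.extend_apply _ _ _

theorem ext0_add {N n : ℕ} {Ω : Set (Sp N)} (v w : CBar Ω n) :
    ext0 (v + w) = ext0 v + ext0 w := by
  funext x
  by_cases hx : x ∈ closure Ω
  · have e := fun v : CBar Ω n => ext0_apply v ⟨x, hx⟩
    simp only at e
    simp [e]
  · have e : ∀ v : CBar Ω n, ext0 v x = 0 := fun v =>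
      Function.extend_apply' _ _ _ (by rintro ⟨y, rfl⟩; exact hx y.2)
    simp [e]

theorem ext0_smul {N n : ℕ} {Ω : Set (Sp N)} (c : ℝ) (v : CBar Ω n) :
    ext0 (c • v) = c • ext0 v := by
  funext x
  by_cases hx : x ∈ closure Ω
  · have e := fun v : CBar Ω n => ext0_apply v ⟨x, hx⟩
    simp only at e
    simp [e]
  · have e : ∀ v : CBar Ω n, ext0 v x = 0 := fun v =>
      Function.extend_apply' _ _ _ (by rintro ⟨y, rfl⟩; exact hx y.2)
    simp [e]

/-- The intersection `W_0^{1,2}(Ω; ℝ^n) ∩ C(closure Ω; ℝ^n)`: the pairs of an element of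
`W_0^{1,2}` and an element of `C(closure Ω)` that agree almost everywhere in `Ω`, with the maximum
of the two norms. -/
def W0C {N : ℕ} (Ω : Set (Sp N)) (n : ℕ) : Submodule ℝ (W012 Ω n × CBar Ω n) where
  carrier := {z | z.1.fn =ᵐ[volume.restrict Ω] ext0 z.2}
  zero_mem' := by
    refine (Lp.coeFn_zero _ _ _).trans (Eventually.of_forall fun x => ?_)
    have h : ext0 (0 : CBar Ω n) = 0 := by
      simpa using ext0_add (0 : CBar Ω n) 0
    change (0 : Sp n) = ext0 (0 : CBar Ω n) x
    rw [h]
    rfl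
  add_mem' := by
    intro z w hz hw
    change _ =ᵐ[_] ext0 (z.2 + w.2)
    rw [ext0_add]
    exact (Lp.coeFn_add _ _).trans (EventuallyEq.add hz hw)
  smul_mem' := by
    intro c z hz
    change _ =ᵐ[_] ext0 (c • z.2)
    rw [ext0_smul]
    exact (Lp.coeFn_smul _ _).trans (EventuallyEq.const_smul (show z.1.fn =ᵐ[_] ext0 z.2 from hz) c)

/-- The inclusion of `W_0^{1,2} ∩ C` into `W_0^{1,2}`. -/
def toW {N : ℕ} (Ω : Set (Sp N)) (n : ℕ) : W0C Ω n →L[ℝ] W012 Ω n :=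
  (ContinuousLinearMap.fst ℝ (W012 Ω n) (CBar Ω n)) ∘L (W0C Ω n).subtypeL

/-- The inclusion of `W_0^{1,2} ∩ C` into `C(closure Ω)`. -/
def toC {N : ℕ} (Ω : Set (Sp N)) (n : ℕ) : W0C Ω n →L[ℝ] CBar Ω n :=
  (ContinuousLinearMap.snd ℝ (W012 Ω n) (CBar Ω n)) ∘L (W0C Ω n).subtypeL

/-! ### Diffusion tensors, the operators `A` and `D`, H-convergence -/

/-- Diffusion tensors: `a α β i j` is the coefficient `a_{ij}^{αβ} ∈ L^∞(Ω)`. -/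
abbrev Tensor {N : ℕ} (Ω : Set (Sp N)) (n : ℕ) : Type :=
  Fin n → Fin n → Fin N → Fin N → Lp ℝ ∞ (volume.restrict Ω)

/-- The Legendre condition with the constant `c`. -/
def IsLegendre {N n : ℕ} {Ω : Set (Sp N)} (c : ℝ) (a : Tensor Ω n) : Prop :=
  ∀ᵐ x ∂(volume.restrict Ω), ∀ v : Gr n N,
    c * ∑ α, ∑ i, v (α, i) ^ 2 ≤ ∑ α, ∑ β, ∑ i, ∑ j, a α β i j x * v (α, i) * v (β, j)

/-- The component `g ↦ g (α, i)`, as a map `L^2(Ω; ℝ^{nN}) → L^2(Ω)`. -/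
def comp {N : ℕ} (Ω : Set (Sp N)) (n : ℕ) (k : Fin n × Fin N) :
    LpGr Ω n 2 →L[ℝ] Lp ℝ 2 (volume.restrict Ω) :=
  (EuclideanSpace.proj k : Gr n N →L[ℝ] ℝ).compLpL 2 (volume.restrict Ω)

/-- The components `∑_{β,j} a_{ij}^{αβ} ∂_{x_j} u^β ∈ L^2(Ω)` of the flux of `u`, as a bounded
linear function of `u ∈ W_0^{1,2}(Ω; ℝ^n)`. -/
def flux {N n : ℕ} {Ω : Set (Sp N)} (a : Tensor Ω n) (α : Fin n) (i : Fin N) :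
    W012 Ω n →L[ℝ] Lp ℝ 2 (volume.restrict Ω) :=
  ∑ β, ∑ j, ((ContinuousLinearMap.mul ℝ ℝ).holderL (volume.restrict Ω) ∞ 2 2 (a α β i j)) ∘L
    (comp Ω n (β, j)) ∘L (grad Ω n)

/-- The bounded linear operator `A : W_0^{1,2}(Ω; ℝ^n) → W^{-1,2}(Ω; ℝ^n)` of the diffusion tensor
`a`, `⟨A u, φ⟩ = ∫_Ω a_{ij}^{αβ} ∂_{x_j} u^β ∂_{x_i} φ^α dx`, see `opA_apply`. -/
def opA {N n : ℕ} {Ω : Set (Sp N)} (a : Tensor Ω n) : W012 Ω n →L[ℝ] Wneg Ω n :=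
  ∑ α, ∑ i, (innerSL ℝ (E := Lp ℝ 2 (volume.restrict Ω))).bilinearComp (flux a α i)
    ((comp Ω n (α, i)) ∘L (grad Ω n))

theorem comp_ae {N n : ℕ} {Ω : Set (Sp N)} (k : Fin n × Fin N) (g : LpGr Ω n 2) :
    comp Ω n k g =ᵐ[volume.restrict Ω] fun x => g x k :=
  ContinuousLinearMap.coeFn_compLp _ _

theorem flux_ae {N n : ℕ} {Ω : Set (Sp N)} (a : Tensor Ω n) (α : Fin n) (i : Fin N)
    (u : W012 Ω n) :
    flux a α i u =ᵐ[volume.restrict Ω]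
      fun x => ∑ β, ∑ j, a α β i j x * grad Ω n u x (β, j) := by
  have h : ∀ β j, ((ContinuousLinearMap.mul ℝ ℝ).holderL (volume.restrict Ω) ∞ 2 2 (a α β i j)
      (comp Ω n (β, j) (grad Ω n u)) : Lp ℝ 2 (volume.restrict Ω)) =ᵐ[volume.restrict Ω]
      fun x => a α β i j x * grad Ω n u x (β, j) := by
    intro β j
    refine ((ContinuousLinearMap.mul ℝ ℝ).coeFn_holder (r := 2) (a α β i j)
      (comp Ω n (β, j) (grad Ω n u))).trans ?_
    filter_upwards [comp_ae (β, j) (grad Ω n u)] with x hx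
    simp [hx]
  simp only [flux, sum_apply, ContinuousLinearMap.comp_apply]
  refine (Lp.coeFn_finsetSum _ _).trans ?_
  have h' := fun β => (Lp.coeFn_finsetSum Finset.univ fun j =>
    ((ContinuousLinearMap.mul ℝ ℝ).holderL (volume.restrict Ω) ∞ 2 2 (a α β i j)
      (comp Ω n (β, j) (grad Ω n u)) : Lp ℝ 2 (volume.restrict Ω)))
  filter_upwards [ae_all_iff.2 fun β => ae_all_iff.2 fun j => h β j, ae_all_iff.2 h']
    with x hx hx'
  rw [Finset.sum_apply]
  refine Finset.sum_congr rfl fun β _ => (hx' β).trans ?_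
  rw [Finset.sum_apply]
  exact Finset.sum_congr rfl fun j _ => hx β j

theorem opA_apply {N n : ℕ} {Ω : Set (Sp N)} (a : Tensor Ω n) (u φ : W012 Ω n) :
    opA a u φ = ∑ α, ∑ i, ∫ x in Ω,
      (∑ β, ∑ j, a α β i j x * grad Ω n u x (β, j)) * grad Ω n φ x (α, i) := by
  simp only [opA, sum_apply, ContinuousLinearMap.bilinearComp_apply,
    ContinuousLinearMap.comp_apply, innerSL_apply_apply, L2.inner_def]
  refine Finset.sum_congr rfl fun α _ => Finset.sum_congr rfl fun i _ => integral_congr_ae ?_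
  filter_upwards [flux_ae a α i u, comp_ae (α, i) (grad Ω n φ)] with x h1 h2
  simp [h1, h2, mul_comm]

/-- The pairing `⟨D g, φ⟩ = ∫_Ω g_i^α ∂_{x_i} φ^α dx` defining the operator `D` with values in
`W^{-1,2}(Ω; ℝ^n)`. -/
def pairD {N n : ℕ} {Ω : Set (Sp N)} (g : Sp N → Gr n N) (φ : W012 Ω n) : ℝ :=
  ∫ x in Ω, ∑ α, ∑ i, g x (α, i) * grad Ω n φ x (α, i)

/-- H-convergence of the diffusion tensors `a ε` for `ε → 0`, `ε > 0`, to `ahat`: for all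
`φ ∈ W^{-1,2}` there is a solution `uhat` of `Ahat uhat = φ` such that the solutions `u ε` of
`A_ε (u ε) = φ` and their fluxes converge weakly to `uhat` in `W_0^{1,2}` and to the flux of `uhat`
in `L^2`, respectively. -/
def HConverges {N n : ℕ} {Ω : Set (Sp N)} (a : ℝ → Tensor Ω n) (ahat : Tensor Ω n) : Prop :=
  ∀ φ : Wneg Ω n, ∃ uhat : W012 Ω n, opA ahat uhat = φ ∧
    ∀ u : ℝ → W012 Ω n, (∀ ε > 0, opA (a ε) (u ε) = φ) →
      (∀ ψ : Wneg Ω n, Tendsto (fun ε => ψ (u ε)) (𝓝[>] 0) (𝓝 (ψ uhat))) ∧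
      ∀ (α : Fin n) (i : Fin N) (ψ : StrongDual ℝ (Lp ℝ 2 (volume.restrict Ω))),
        Tendsto (fun ε => ψ (flux (a ε) α i (u ε))) (𝓝[>] 0) (𝓝 (ψ (flux ahat α i uhat)))

/-! ### Superposition operators and weak solutions -/

/-- The function `x ↦ [f_i^α(x, v(x))]`. -/
def superpos {N n : ℕ} {Ω : Set (Sp N)} (f : Fin n → Fin N → Sp N → Sp n → ℝ) (v : CBar Ω n)
    (x : Sp N) : Gr n N :=
  WithLp.toLp 2 fun k => f k.1 k.2 x (ext0 v x)

/-- The superposition operator `F : C(closure Ω; ℝ^n) → L^p(Ω; ℝ^{nN})` generated by `f`. -/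
def opF {N n : ℕ} {Ω : Set (Sp N)} (f : Fin n → Fin N → Sp N → Sp n → ℝ) (p : ℝ≥0∞)
    (hf : ∀ v : CBar Ω n, MemLp (superpos f v) p (volume.restrict Ω)) (v : CBar Ω n) :
    LpGr Ω n p :=
  (hf v).toLp

/-- `u ∈ W_0^{1,2} ∩ C` is a weak solution of the Dirichlet problem
`∂_{x_i} (a_{ij}^{αβ} ∂_{x_j} u^β + f_i^α(x, u)) = 0` in `Ω`, `u = 0` on `∂Ω`. -/
def IsWeakSolution {N n : ℕ} {Ω : Set (Sp N)} (a : Tensor Ω n)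
    (f : Fin n → Fin N → Sp N → Sp n → ℝ) (u : W0C Ω n) : Prop :=
  ∀ φ : W012 Ω n, ∫ x in Ω, ∑ α, ∑ i,
    ((∑ β, ∑ j, a α β i j x * grad Ω n (toW Ω n u) x (β, j)) +
      f α i x (ext0 (toC Ω n u) x)) * grad Ω n φ x (α, i) = 0

/-! ### The fixed point problem -/

/-- The operator `A + D F'(u₀) : U → V`, where `dF` is `F'(u₀)` and `jC` the embedding of `U` into
`C(closure Ω)`. -/
def linOp {N n : ℕ} {Ω : Set (Sp N)} {p : ℝ≥0∞} [Fact (1 ≤ p)] {U V : Type*}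
    [NormedAddCommGroup U] [NormedSpace ℝ U] [NormedAddCommGroup V] [NormedSpace ℝ V]
    (A : U →L[ℝ] V) (D : LpGr Ω n p →L[ℝ] V) (dF : CBar Ω n →L[ℝ] LpGr Ω n p)
    (jC : U →L[ℝ] CBar Ω n) : U →L[ℝ] V :=
  A + D ∘L dF ∘L jC

/-- The map `G(u) = u - (A + D F'(u₀))⁻¹ (A u + D F(u))` of `U` into itself, for bijective
`A + D F'(u₀)`. -/
def fixMap {N n : ℕ} {Ω : Set (Sp N)} {p : ℝ≥0∞} [Fact (1 ≤ p)] {U V : Type*}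
    [NormedAddCommGroup U] [NormedSpace ℝ U] [NormedAddCommGroup V] [NormedSpace ℝ V]
    (A : U →L[ℝ] V) (D : LpGr Ω n p →L[ℝ] V) (F : CBar Ω n → LpGr Ω n p) (u₀ : CBar Ω n)
    (jC : U →L[ℝ] CBar Ω n) (u : U) : U :=
  u - (linOp A D (fderiv ℝ F u₀) jC).inverse (A u + D (F (jC u)))

/-- The approximate solution `-A⁻¹ D F(u₀) ∈ U`, for bijective `A`. -/
def approxSol {N n : ℕ} {Ω : Set (Sp N)} {p : ℝ≥0∞} [Fact (1 ≤ p)] {U V : Type*}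
    [NormedAddCommGroup U] [NormedSpace ℝ U] [NormedAddCommGroup V] [NormedSpace ℝ V]
    (A : U →L[ℝ] V) (D : LpGr Ω n p →L[ℝ] V) (F : CBar Ω n → LpGr Ω n p) (u₀ : CBar Ω n) : U :=
  -A.inverse (D (F u₀))

end Homog

end

open Homog

/-!
A weak limit of inverses `A_ε⁻¹` of uniformly bounded and coercive operators is again coercive.
Hence the H-limit `Â` is injective, and `u_ε ⇀ û` in `W` whenever `A_ε u_ε → Â û` in `W*`. Together
with the compactness of `U ↪ C`, this shows that limits in `C` of elements `u_ε` of `U` for which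
`A_ε u_ε` converges in `V` solve the homogenized equation. Applied to `A_ε ū_ε = -D F(u₀)`, it
yields `ū_ε → u₀` in `C`. Applied to a normalized sequence that violates a uniform lower bound for
`A_ε + D F'(u₀)`, it yields a nonzero solution of `Â u + D F'(u₀) u = 0`, so these operators have
uniformly bounded inverses. Since `D F` is, near `u₀` in `C`, uniformly close to its linearization,
the quantitative inverse function theorem at `ū_ε` gives a unique zero of `A_ε + D F` there, at a
distance controlled by the residual. Bijectivity of `A_ε : U → V` and injectivity of
`A_ε : W → W*` place every weak solution in `W ∩ C` in `U`.
-/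

namespace Homog

section Coercive

variable {W : Type*} [NormedAddCommGroup W]

theorem mul_norm_le_norm_of_coercive [NormedSpace ℝ W] {B : W →L[ℝ] StrongDual ℝ W} {c : ℝ}
    (hB : ∀ u, c * ‖u‖ ^ 2 ≤ B u u) (u : W) : c * ‖u‖ ≤ ‖B u‖ := by
  rcases (norm_nonneg u).eq_or_lt with hu | hu
  · simp [← hu]
  refine le_of_mul_le_mul_right ?_ hu
  calc c * ‖u‖ * ‖u‖ = c * ‖u‖ ^ 2 := by ring
    _ ≤ B u u := hB u
    _ ≤ ‖B u‖ * ‖u‖ := (Real.le_norm_self _).trans ((B u).le_opNorm u)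

variable [InnerProductSpace ℝ W] [CompleteSpace W]

theorem isInvertible_of_coercive {B : W →L[ℝ] StrongDual ℝ W} {c : ℝ} (hc : 0 < c)
    (hB : ∀ u, c * ‖u‖ ^ 2 ≤ B u u) : B.IsInvertible := by
  have hB' : IsCoercive B := ⟨c, hc, fun u => by simpa only [sq, mul_assoc] using hB u⟩
  refine ⟨hB'.continuousLinearEquivOfBilin.trans
    (InnerProductSpace.toDual ℝ W).toContinuousLinearEquiv, ?_⟩
  ext u w
  exact hB'.continuousLinearEquivOfBilin_apply u w

theorem norm_inverse_apply_le_of_coercive {B : W →L[ℝ] StrongDual ℝ W} {c : ℝ} (hc : 0 < c)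
    (hB : ∀ u, c * ‖u‖ ^ 2 ≤ B u u) (φ : StrongDual ℝ W) : ‖B.inverse φ‖ ≤ c⁻¹ * ‖φ‖ := by
  have h := mul_norm_le_norm_of_coercive hB (B.inverse φ)
  rwa [(isInvertible_of_coercive hc hB).self_apply_inverse, ← le_inv_mul_iff₀ hc] at h

theorem mul_norm_sq_le_apply_inverse_of_coercive {B : W →L[ℝ] StrongDual ℝ W} {c M : ℝ}
    (hc : 0 < c) (hB : ∀ u, c * ‖u‖ ^ 2 ≤ B u u) (hM : ∀ u, ‖B u‖ ≤ M * ‖u‖) (φ : StrongDual ℝ W) :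
    c * ‖φ‖ ^ 2 ≤ M ^ 2 * φ (B.inverse φ) := by
  have hinv : B (B.inverse φ) = φ := (isInvertible_of_coercive hc hB).self_apply_inverse φ
  have hφ : ‖φ‖ ≤ M * ‖B.inverse φ‖ :=
    calc ‖φ‖ = ‖B (B.inverse φ)‖ := by rw [hinv]
      _ ≤ M * ‖B.inverse φ‖ := hM _
  have hcoe := hB (B.inverse φ)
  rw [hinv] at hcoe
  calc c * ‖φ‖ ^ 2 ≤ c * (M * ‖B.inverse φ‖) ^ 2 := by gcongr
    _ = M ^ 2 * (c * ‖B.inverse φ‖ ^ 2) := by ring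
    _ ≤ M ^ 2 * φ (B.inverse φ) := by gcongr

theorem surjective_of_coercive_of_dual {S : StrongDual ℝ W →L[ℝ] W} {c : ℝ} (hc : 0 < c)
    (hS : ∀ φ : StrongDual ℝ W, c * ‖φ‖ ^ 2 ≤ φ (S φ)) : Function.Surjective S := fun u => by
  let J : W ≃L[ℝ] StrongDual ℝ W := (InnerProductSpace.toDual ℝ W).toContinuousLinearEquiv
  have hT : ((J : W →L[ℝ] StrongDual ℝ W) ∘L S ∘L (J : W →L[ℝ] StrongDual ℝ W)).IsInvertible := by
    refine isInvertible_of_coercive hc fun w => ?_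
    simpa [J, real_inner_comm] using hS (J w)
  obtain ⟨w, hw⟩ := hT.surjective (J u)
  exact ⟨J w, J.injective hw⟩

/-- G-convergence of the operators `B k` to `Bhat` along `l`: every right-hand side `φ` has a
solution of `Bhat u = φ` that is the weak limit of the solutions of `B k u = φ`. Only meaningful
for eventually invertible `B k`, since `ContinuousLinearMap.inverse` is `0` otherwise. -/
def GConverges {κ : Type*} (l : Filter κ) (B : κ → W →L[ℝ] StrongDual ℝ W)
    (Bhat : W →L[ℝ] StrongDual ℝ W) : Prop :=
  ∀ φ, ∃ u, Bhat u = φ ∧ ∀ ψ : StrongDual ℝ W,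
    Tendsto (fun k => ψ ((B k).inverse φ)) l (𝓝 (ψ u))

namespace GConverges

variable {κ : Type*} {l : Filter κ} [l.NeBot] {B : κ → W →L[ℝ] StrongDual ℝ W}
  {Bhat : W →L[ℝ] StrongDual ℝ W} {c M : ℝ}

theorem exists_rightInverse (hG : GConverges l B Bhat) (hc : 0 < c)
    (hB : ∀ᶠ k in l, ∀ u, c * ‖u‖ ^ 2 ≤ B k u u) :
    ∃ S : StrongDual ℝ W →L[ℝ] W, (∀ φ, Bhat (S φ) = φ) ∧
      ∀ φ ψ : StrongDual ℝ W, Tendsto (fun k => ψ ((B k).inverse φ)) l (𝓝 (ψ (S φ))) := by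
  choose S hBS hS using hG
  have weakLimit_unique {u v : W} (h : ∀ ψ : StrongDual ℝ W, ψ u = ψ v) : u = v :=
    (SeparatingDual.eq_iff_forall_dual_eq (R := ℝ)).2 h
  refine ⟨LinearMap.mkContinuous
    { toFun := S
      map_add' := fun φ φ' => weakLimit_unique fun ψ => ?_
      map_smul' := fun t φ => weakLimit_unique fun ψ => ?_ } c⁻¹ fun φ => ?_, hBS, hS⟩
  · refine tendsto_nhds_unique (hS (φ + φ') ψ) ?_
    simpa only [map_add] using (hS φ ψ).add (hS φ' ψ)
  · refine tendsto_nhds_unique (hS (t • φ) ψ) ?_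
    simpa only [map_smul, RingHom.id_apply] using (hS φ ψ).const_smul t
  · refine NormedSpace.norm_le_dual_bound ℝ _ (by positivity) fun ψ => ?_
    refine le_of_tendsto (hS φ ψ).norm (hB.mono fun k hk => ?_)
    rw [mul_comm]
    exact ψ.le_opNorm_of_le (norm_inverse_apply_le_of_coercive hc hk φ)

/-- The estimate `c ‖φ‖² ≤ M² ⟨φ, B⁻¹ φ⟩` is inherited by the weak limit of the inverses, which is
therefore invertible by the Lax–Milgram lemma. -/
theorem injective (hG : GConverges l B Bhat) (hc : 0 < c)
    (hB : ∀ᶠ k in l, ∀ u, c * ‖u‖ ^ 2 ≤ B k u u) (hM : ∀ᶠ k in l, ∀ u, ‖B k u‖ ≤ M * ‖u‖) :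
    Function.Injective Bhat := by
  obtain ⟨S, hBS, hS⟩ := hG.exists_rightInverse hc hB
  have hS_coercive (φ : StrongDual ℝ W) : c * ‖φ‖ ^ 2 ≤ M ^ 2 * φ (S φ) := by
    refine ge_of_tendsto ((hS φ φ).const_mul (M ^ 2)) ?_
    filter_upwards [hB, hM] with k hBk hMk
    exact mul_norm_sq_le_apply_inverse_of_coercive hc hBk hMk φ
  have hS_surj : Function.Surjective S := fun u => by
    obtain ⟨φ, hφ⟩ := surjective_of_coercive_of_dual (S := M ^ 2 • S) hc
      (by simpa only [smul_apply, map_smul, smul_eq_mul] using hS_coercive) u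
    exact ⟨M ^ 2 • φ, by rw [map_smul]; exact hφ⟩
  exact (Function.RightInverse.leftInverse_of_surjective hBS hS_surj).injective

theorem tendsto_inverse_apply (hG : GConverges l B Bhat) (hc : 0 < c)
    (hB : ∀ᶠ k in l, ∀ u, c * ‖u‖ ^ 2 ≤ B k u u) (hM : ∀ᶠ k in l, ∀ u, ‖B k u‖ ≤ M * ‖u‖) (u : W)
    (ψ : StrongDual ℝ W) : Tendsto (fun k => ψ ((B k).inverse (Bhat u))) l (𝓝 (ψ u)) := by
  obtain ⟨v, hv, hvψ⟩ := hG (Bhat u)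
  rw [← hG.injective hc hB hM hv]
  exact hv ▸ hvψ ψ

theorem tendsto_of_tendsto_apply (hG : GConverges l B Bhat) (hc : 0 < c)
    (hB : ∀ᶠ k in l, ∀ u, c * ‖u‖ ^ 2 ≤ B k u u) (hM : ∀ᶠ k in l, ∀ u, ‖B k u‖ ≤ M * ‖u‖)
    {X : Type*} {m : Filter X} {e : X → κ} (he : Tendsto e m l) {w : X → W} {u : W}
    (hw : Tendsto (fun x => B (e x) (w x)) m (𝓝 (Bhat u))) (ψ : StrongDual ℝ W) :
    Tendsto (fun x => ψ (w x)) m (𝓝 (ψ u)) := by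
  have hdiff : Tendsto (fun x => w x - (B (e x)).inverse (Bhat u)) m (𝓝 0) := by
    refine squeeze_zero_norm' ?_ (by
      simpa only [mul_zero] using (tendsto_iff_norm_sub_tendsto_zero.1 hw).const_mul c⁻¹)
    filter_upwards [he.eventually hB] with x hx
    have h := norm_inverse_apply_le_of_coercive hc hx (B (e x) (w x) - Bhat u)
    rwa [map_sub, (isInvertible_of_coercive hc hx).inverse_apply_self] at h
  have h := ((ψ.continuous.tendsto 0).comp hdiff).add
    ((hG.tendsto_inverse_apply hc hB hM u ψ).comp he)
  simpa only [Function.comp_def, map_sub, map_zero, sub_add_cancel, zero_add] using h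

end GConverges

end Coercive

section LimitGraph

variable {κ U E V : Type*} [TopologicalSpace E] [TopologicalSpace V]

/-- The Kuratowski upper limit along `l` of the sets `{(j u, A k u) | u : U}`: the limits of
`(j u, A k u)` along ultrafilters for which `k` tends to `l` and `u` is arbitrary. -/
def limitGraph (l : Filter κ) (j : U → E) (A : κ → U → V) : Set (E × V) :=
  {p | MapClusterPt p (comap Prod.fst l) fun q : κ × U => (j q.2, A q.1 q.2)}

variable {l : Filter κ} {j : U → E} {A : κ → U → V}

theorem mem_limitGraph_iff_ultrafilter {v : E} {g : V} :
    (v, g) ∈ limitGraph l j A ↔ ∃ m : Ultrafilter (κ × U),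
      Tendsto (fun q : κ × U => q.1) m l ∧
      Tendsto (fun q : κ × U => j q.2) m (𝓝 v) ∧ Tendsto (fun q : κ × U => A q.1 q.2) m (𝓝 g) := by
  simp only [limitGraph, mem_ofPred_eq, mapClusterPt_iff_ultrafilter, ← tendsto_iff_comap,
    nhds_prod_eq, tendsto_prod_iff']

theorem mem_limitGraph_of_tendsto {X : Type*} {m : Filter X} [m.NeBot]
    {e : X → κ} (he : Tendsto e m l) {w : X → U} {v : E} {g : V}
    (hj : Tendsto (fun x => j (w x)) m (𝓝 v))
    (hA : Tendsto (fun x => A (e x) (w x)) m (𝓝 g)) : (v, g) ∈ limitGraph l j A :=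
  MapClusterPt.of_comp (φ := fun x => (e x, w x)) (tendsto_comap_iff.2 he)
    (hj.prodMk_nhds hA).mapClusterPt

end LimitGraph

section UniformInvertibility

variable {U E V : Type*} [NormedAddCommGroup U] [NormedSpace ℝ U] [NormedAddCommGroup E]
  [NormedSpace ℝ E] [NormedAddCommGroup V] [NormedSpace ℝ V]

theorem isInvertible_of_bijective [CompleteSpace U] [CompleteSpace V] {T : U →L[ℝ] V}
    (hT : Function.Bijective T) : T.IsInvertible :=
  ⟨.ofBijective T (LinearMap.ker_eq_bot.2 hT.1) (LinearMap.range_eq_top.2 hT.2),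
    ContinuousLinearEquiv.coe_ofBijective T _ _⟩

theorem isInvertible_add_of_isCompactOperator [CompleteSpace U] {A K : U →L[ℝ] V}
    (hA : A.IsInvertible) (hK : IsCompactOperator K) (hinj : Function.Injective (A + K)) :
    (A + K).IsInvertible := by
  set S : U →L[ℝ] U := A.inverse ∘L K
  have hAS : A + K = A ∘L (-(algebraMap ℝ (U →L[ℝ] U) (-1) - S)) := by
    ext u
    simp [S, Algebra.algebraMap_eq_smul_one, hA.self_apply_inverse, add_comm]
  have hS : IsCompactOperator S := hK.clm_comp A.inverse
  rcases hS.hasEigenvalue_or_mem_resolventSet (μ := (-1 : ℝ)) (by norm_num) with h | h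
  · obtain ⟨x, hx⟩ := h.exists_hasEigenvector
    have hSx : S x = -x := by simpa using hx.apply_eq_smul
    refine absurd (hinj ?_) hx.2
    simp [hAS, Algebra.algebraMap_eq_smul_one, hSx]
  · rw [hAS]
    exact hA.comp ⟨.ofUnit (IsUnit.neg h).unit, rfl⟩

theorem norm_inverse_le_of_mul_norm_le {T : U →L[ℝ] V} (hT : T.IsInvertible) {c : ℝ} (hc : 0 < c)
    (h : ∀ u, c * ‖u‖ ≤ ‖T u‖) : ‖T.inverse‖ ≤ c⁻¹ := by
  refine ContinuousLinearMap.opNorm_le_bound _ (by positivity) fun y => ?_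
  simpa only [hT.self_apply_inverse, ← le_inv_mul_iff₀ hc] using h (T.inverse y)

theorem norm_le_of_norm_inverse_le {T : U →L[ℝ] V} (hT : T.IsInvertible) {C : ℝ}
    (hC : ‖T.inverse‖ ≤ C) (u : U) : ‖u‖ ≤ C * ‖T u‖ := by
  simpa only [hT.inverse_apply_self] using T.inverse.le_of_opNorm_le hC (T u)

variable {κ : Type*} {l : Filter κ} {j : U →L[ℝ] E} {A : κ → U →L[ℝ] V}

theorem exists_tendsto_of_isCompactOperator (hj : IsCompactOperator j) {X : Type*}
    {m : Ultrafilter X} {w : X → U} {r : ℝ} (hw : ∀ᶠ x in m, ‖w x‖ ≤ r) :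
    ∃ v, Tendsto (fun x => j (w x)) m (𝓝 v) := by
  obtain ⟨Q, hQ, hsub⟩ := hj.image_closedBall_subset_compact (f := (j : U →ₗ[ℝ] E)) r
  obtain ⟨v, -, hv⟩ := hQ.ultrafilter_le_nhds' (m.map fun x => j (w x)) <|
    hw.mono fun x hx => hsub ⟨w x, by simpa using hx, rfl⟩
  exact ⟨v, hv⟩

theorem tendsto_of_limitGraph_unique (hj : IsCompactOperator j) {C : ℝ}
    (hA : ∀ᶠ k in l, ∀ u, ‖u‖ ≤ C * ‖A k u‖) {g : V} {v₀ : E}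
    (hv₀ : ∀ v, (v, g) ∈ limitGraph l j (fun k => A k) → v = v₀) {w : κ → U}
    (hw : Tendsto (fun k => A k (w k)) l (𝓝 g)) : Tendsto (fun k => j (w k)) l (𝓝 v₀) := by
  refine (tendsto_iff_ultrafilter _ _ _).2 fun m hm => ?_
  have hw_bdd : ∀ᶠ k in m, ‖w k‖ ≤ |C| * (‖g‖ + 1) := by
    filter_upwards [hm hA, (hw.mono_left hm).norm.eventually_le_const (lt_add_one ‖g‖)] with k hk hg
    exact (hk (w k)).trans (by gcongr; exact le_abs_self C)
  obtain ⟨v, hv⟩ := exists_tendsto_of_isCompactOperator hj hw_bdd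
  exact hv₀ v (mem_limitGraph_of_tendsto (e := id) hm hv (hw.mono_left hm)) ▸ hv

theorem exists_mul_norm_le_norm_add_apply (hj : IsCompactOperator j) {C : ℝ}
    (hA : ∀ᶠ k in l, ∀ u, ‖u‖ ≤ C * ‖A k u‖) {K : E →L[ℝ] V}
    (hK : ∀ v, (v, -K v) ∈ limitGraph l j (fun k => A k) → v = 0) :
    ∃ c > 0, ∀ᶠ k in l, ∀ u, c * ‖u‖ ≤ ‖(A k + K ∘L j) u‖ := by
  suffices h : ∃ c > 0, ∀ᶠ q : κ × U in l ×ˢ 𝓟 (Metric.sphere 0 1),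
      c ≤ ‖(A q.1 + K ∘L j) q.2‖ by
    obtain ⟨c, hc, h⟩ := h
    refine ⟨c, hc, (eventually_prod_principal_iff.1 h).mono fun k hk u => ?_⟩
    rcases eq_or_ne u 0 with rfl | hu
    · simp
    have hu' := hk (‖u‖⁻¹ • u) (by simpa using norm_smul_inv_norm (𝕜 := ℝ) hu)
    rwa [map_smul, norm_smul, norm_inv, norm_norm, le_inv_mul_iff₀ (norm_pos_iff.2 hu),
      mul_comm] at hu'
  by_contra! h
  have hcluster : MapClusterPt 0 (l ×ˢ 𝓟 (Metric.sphere (0 : U) 1))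
      fun q => (A q.1 + K ∘L j) q.2 := by
    refine Metric.nhds_basis_ball.mapClusterPt_iff_frequently.2 fun c hc => ?_
    simpa only [mem_ball_zero_iff] using h c hc
  obtain ⟨m, hml, hm⟩ := mapClusterPt_iff_ultrafilter.1 hcluster
  have hsphere : ∀ᶠ q in (m : Filter (κ × U)), ‖q.2‖ = 1 := by
    filter_upwards [hml (tendsto_snd (mem_principal_self _))] with q hq using by simpa using hq
  have hfst : Tendsto (fun q : κ × U => q.1) m l := tendsto_fst.mono_left hml
  obtain ⟨v, hv⟩ := exists_tendsto_of_isCompactOperator hj (hsphere.mono fun _ => le_of_eq)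
  have hKv := (K.continuous.tendsto v).comp hv
  have hAv : Tendsto (fun q : κ × U => A q.1 q.2) m (𝓝 (-K v)) := by
    simpa [Function.comp_def] using hm.sub hKv
  obtain rfl : v = 0 := hK v (mem_limitGraph_of_tendsto hfst hv hAv)
  rw [map_zero, neg_zero] at hAv
  have hone : (1 : ℝ) ≤ C * 0 := by
    refine ge_of_tendsto (hAv.norm.const_mul C |>.trans (by simp)) ?_
    filter_upwards [hfst.eventually hA, hsphere] with q hq hq1 using hq1 ▸ hq q.2
  norm_num at hone

/-- Uniform bounds for `A k + K j` survive the limit because a normalized sequence violating them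
would, by compactness of `j`, produce a nonzero solution of the limit equation. -/
theorem exists_eventually_isInvertible_add [CompleteSpace U] (hj : IsCompactOperator j) {C : ℝ}
    (hA : ∀ᶠ k in l, (A k).IsInvertible) (hC : ∀ᶠ k in l, ‖(A k).inverse‖ ≤ C) {K : E →L[ℝ] V}
    (hK : ∀ v, (v, -K v) ∈ limitGraph l j (fun k => A k) → v = 0) :
    ∃ C' > 0, ∀ᶠ k in l, (A k + K ∘L j).IsInvertible ∧ ‖(A k + K ∘L j).inverse‖ ≤ C' := by
  obtain ⟨c, hc, h⟩ := exists_mul_norm_le_norm_add_apply hj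
    ((hA.and hC).mono fun k hk => norm_le_of_norm_inverse_le hk.1 hk.2) hK
  refine ⟨c⁻¹, inv_pos.2 hc, ?_⟩
  filter_upwards [hA, h] with k hAk hk
  have hinj : Function.Injective (A k + K ∘L j) :=
    (injective_iff_map_eq_zero _).2 fun u hu => norm_le_zero_iff.1 <|
      nonpos_of_mul_nonpos_right ((hk u).trans_eq (by rw [hu, norm_zero])) hc
  have hinv := isInvertible_add_of_isCompactOperator hAk (hj.clm_comp K) hinj
  exact ⟨hinv, norm_inverse_le_of_mul_norm_le hinv hc hk⟩

end UniformInvertibility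

section SemilinearEquation

variable {U V : Type*} [NormedAddCommGroup U] [NormedSpace ℝ U] [NormedAddCommGroup V]
  [NormedSpace ℝ V]

theorem injOn_of_approximatesLinearOn {H : U → V} {T : U →L[ℝ] V} {s : Set U} {c : NNReal} {C : ℝ}
    (hH : ApproximatesLinearOn H T s c) (hT : T.IsInvertible) (hC : 0 < C) (hTC : ‖T.inverse‖ ≤ C)
    (hCc : C * c < 1) : InjOn H s := by
  intro u hu v hv huv
  have hle : ‖u - v‖ ≤ C * c * ‖u - v‖ :=
    calc ‖u - v‖ ≤ C * ‖T (u - v)‖ := norm_le_of_norm_inverse_le hT hTC _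
      _ ≤ C * (c * ‖u - v‖) := by
        gcongr
        simpa only [huv, sub_self, zero_sub, norm_neg] using hH u hu v hv
      _ = C * c * ‖u - v‖ := by ring
  refine sub_eq_zero.1 (norm_le_zero_iff.1 ?_)
  nlinarith [norm_nonneg (u - v)]

theorem exists_unique_zero_of_approximatesLinearOn [CompleteSpace U] {H : U → V} {T : U →L[ℝ] V}
    {s : Set U} {c : NNReal} {C : ℝ} (hH : ApproximatesLinearOn H T s c) (hT : T.IsInvertible)
    (hC : 0 < C) (hTC : ‖T.inverse‖ ≤ C) (hCc : C * c ≤ 1 / 2) {b : U}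
    (hb : Metric.closedBall b (2 * C * ‖H b‖) ⊆ s) :
    ∃ u ∈ Metric.closedBall b (2 * C * ‖H b‖), ∀ v ∈ s, H v = 0 ↔ v = u := by
  have hinj := injOn_of_approximatesLinearOn hH hT hC hTC (hCc.trans_lt (by norm_num))
  let R : T.NonlinearRightInverse :=
    { toFun := T.inverse
      nnnorm := ⟨C, hC.le⟩
      bound' := T.inverse.le_of_opNorm_le hTC
      right_inv' := hT.self_apply_inverse }
  have hsurj := hH.surjOn_closedBall_of_nonlinearRightInverse R (by positivity) hb
  have hzero : 0 ∈ Metric.closedBall (H b) ((C⁻¹ - c) * (2 * C * ‖H b‖)) := by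
    have hfactor : 1 ≤ (C⁻¹ - c) * (2 * C) := by
      rw [sub_mul, ← mul_assoc, mul_comm C⁻¹, mul_assoc, inv_mul_cancel₀ hC.ne']
      linarith
    rw [mem_closedBall_iff_norm', sub_zero, ← mul_assoc]
    exact le_mul_of_one_le_left (norm_nonneg _) hfactor
  obtain ⟨u, hu, hHu⟩ := hsurj hzero
  exact ⟨u, hu, fun v hv => ⟨fun h => hinj hv (hb hu) (h.trans hHu.symm), fun h => h ▸ hHu⟩⟩

variable {E L : Type*} [NormedAddCommGroup E] [NormedSpace ℝ E] [NormedAddCommGroup L]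
  [NormedSpace ℝ L]

theorem approximatesLinearOn_add_comp {F : E → L} {dF : E →L[ℝ] L} {s : Set E} {η : NNReal}
    (hF : ApproximatesLinearOn F dF s η) (A : U →L[ℝ] V) (D : L →L[ℝ] V) (j : U →L[ℝ] E) :
    ApproximatesLinearOn (fun u => A u + D (F (j u))) (A + D ∘L dF ∘L j) (j ⁻¹' s)
      (‖D‖₊ * η * ‖j‖₊) := by
  intro u hu v hv
  have hrem : A u + D (F (j u)) - (A v + D (F (j v))) - (A + D ∘L dF ∘L j) (u - v) =
      D (F (j u) - F (j v) - dF (j u - j v)) := by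
    simp only [add_apply, ContinuousLinearMap.comp_apply, map_sub]
    abel
  calc _ = ‖D (F (j u) - F (j v) - dF (j u - j v))‖ := by rw [← hrem]
    _ ≤ ‖D‖ * (η * ‖j (u - v)‖) := by
      rw [map_sub j]
      exact D.le_opNorm_of_le (hF _ hu _ hv)
    _ ≤ ‖D‖ * (η * (‖j‖ * ‖u - v‖)) := by gcongr; exact j.le_opNorm _
    _ = ↑(‖D‖₊ * η * ‖j‖₊) * ‖u - v‖ := by push_cast; ring

theorem closedBall_subset_preimage_ball (j : U →L[ℝ] E) {b : U} {c₀ : E} {δ : ℝ}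
    (hb : ‖j b - c₀‖ < δ / 2) :
    Metric.closedBall b (δ / (2 * (‖j‖ + 1))) ⊆ j ⁻¹' Metric.ball c₀ δ := by
  intro v hv
  rw [mem_closedBall_iff_norm, le_div_iff₀ (by positivity)] at hv
  rw [mem_preimage, mem_ball_iff_norm]
  have hjv : ‖j (v - b)‖ ≤ δ / 2 := (j.le_opNorm _).trans (by nlinarith [norm_nonneg (v - b)])
  calc ‖j v - c₀‖ = ‖j (v - b) + (j b - c₀)‖ := by rw [map_sub, sub_add_sub_cancel]
    _ < δ := by linarith [norm_add_le (j (v - b)) (j b - c₀)]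

theorem exists_zeros_of_approximate_zeros [CompleteSpace U] {κ : Type*} {l : Filter κ} [l.NeBot]
    {A : κ → U →L[ℝ] V} {j : U →L[ℝ] E} {D : L →L[ℝ] V} {F : E → L} {dF : E →L[ℝ] L} {c₀ : E}
    (hF : HasStrictFDerivAt F dF c₀) {C : ℝ} (hC : 0 < C)
    (hT : ∀ᶠ k in l, (A k + D ∘L dF ∘L j).IsInvertible ∧ ‖(A k + D ∘L dF ∘L j).inverse‖ ≤ C)
    {b : κ → U} (hb : Tendsto (fun k => j (b k)) l (𝓝 c₀))
    (hres : Tendsto (fun k => A k (b k) + D (F (j (b k)))) l (𝓝 0)) :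
    ∃ δ > 0, ∃ r > 0, ∃ u : κ → U,
      ((fun k => u k - b k) =O[l] fun k => A k (b k) + D (F (j (b k)))) ∧
      ∀ᶠ k in l, u k ∈ Metric.closedBall (b k) r ∧
        Metric.closedBall (b k) r ⊆ j ⁻¹' Metric.ball c₀ δ ∧
        ∀ v, j v ∈ Metric.ball c₀ δ → (A k v + D (F (j v)) = 0 ↔ v = u k) := by
  obtain ⟨η, hη, hCη⟩ : ∃ η : NNReal, 0 < η ∧ C * ↑(‖D‖₊ * η * ‖j‖₊) ≤ 1 / 2 := by
    obtain ⟨η, hη, hlt⟩ := exists_pos_mul_lt (one_half_pos (α := ℝ)) (C * ‖D‖ * ‖j‖)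
    lift η to NNReal using hη.le
    refine ⟨η, hη, le_of_eq_of_le ?_ hlt.le⟩
    push_cast
    ring
  obtain ⟨s, hs, hFs⟩ := hF.approximates_deriv_on_nhds (Or.inr hη)
  obtain ⟨δ, hδ, hδs⟩ := Metric.mem_nhds_iff.1 hs
  set r := δ / (2 * (‖j‖ + 1))
  have hr : 0 < r := by positivity
  have hball : ∀ᶠ k in l, Metric.closedBall (b k) r ⊆ j ⁻¹' Metric.ball c₀ δ := by
    filter_upwards [(tendsto_iff_norm_sub_tendsto_zero.1 hb).eventually_lt_const (half_pos hδ)]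
      with k hk using closedBall_subset_preimage_ball j hk
  have hres' : ∀ᶠ k in l, 2 * C * ‖A k (b k) + D (F (j (b k)))‖ ≤ r := by
    have := hres.norm.const_mul (2 * C)
    rw [norm_zero, mul_zero] at this
    exact this.eventually_le_const hr
  obtain ⟨u, hu⟩ := Eventually.choice <| show ∀ᶠ k in l, ∃ u,
      u ∈ Metric.closedBall (b k) (2 * C * ‖A k (b k) + D (F (j (b k)))‖) ∧
        ∀ v ∈ j ⁻¹' Metric.ball c₀ δ, A k v + D (F (j v)) = 0 ↔ v = u by
    filter_upwards [hT, hball, hres'] with k hTk hballk hresk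
    exact exists_unique_zero_of_approximatesLinearOn
      (approximatesLinearOn_add_comp (hFs.mono_set hδs) (A k) D j) hTk.1 hC hTk.2 hCη
      ((Metric.closedBall_subset_closedBall hresk).trans hballk)
  refine ⟨δ, hδ, r, hr, u, ?_, ?_⟩
  · exact .of_bound (2 * C) (hu.mono fun k hk => mem_closedBall_iff_norm.1 hk.1)
  · filter_upwards [hu, hball, hres'] with k huk hballk hresk
    exact ⟨Metric.closedBall_subset_closedBall hresk huk.1, hballk, huk.2⟩

theorem isBigO_map_sub_of_isBigO_sub {X : Type*} [SeminormedAddCommGroup X] {κ : Type*}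
    {l : Filter κ} (j : U →L[ℝ] E) {u b : κ → U} {c₀ : E} {res : κ → X}
    (h : (fun k => u k - b k) =O[l] res) :
    (fun k => j (u k) - c₀) =O[l] fun k => ‖j (b k) - c₀‖ + ‖res k‖ := by
  have hu : (fun k => j (u k - b k)) =O[l] fun k => ‖j (b k) - c₀‖ + ‖res k‖ :=
    (j.isBigO_comp _ l).trans <| h.trans <| .of_norm_le fun k => by simp
  have hb : (fun k => j (b k) - c₀) =O[l] fun k => ‖j (b k) - c₀‖ + ‖res k‖ :=
    .of_norm_le fun k => by simp
  simpa only [map_sub, sub_add_sub_cancel] using hu.add hb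

theorem exists_zeros_of_limitGraph_unique [CompleteSpace U] {κ : Type*} {l : Filter κ} [l.NeBot]
    {A : κ → U →L[ℝ] V} {j : U →L[ℝ] E} {D : L →L[ℝ] V} {F : E → L} {dF : E →L[ℝ] L} {c₀ : E}
    {C : ℝ} (hj : IsCompactOperator j) (hA : ∀ᶠ k in l, (A k).IsInvertible)
    (hC : ∀ᶠ k in l, ‖(A k).inverse‖ ≤ C) (hF : HasStrictFDerivAt F dF c₀)
    (hc₀ : ∀ v, (v, -D (F c₀)) ∈ limitGraph l j (fun k => A k) → v = c₀)
    (hdF : ∀ v, (v, -D (dF v)) ∈ limitGraph l j (fun k => A k) → v = 0)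
    {b : κ → U} (hb : ∀ᶠ k in l, A k (b k) = -D (F c₀)) :
    (∃ C' : ℝ, ∀ᶠ k in l,
      (A k + D ∘L dF ∘L j).IsInvertible ∧ ‖(A k + D ∘L dF ∘L j).inverse‖ ≤ C') ∧
    ∃ δ > 0, ∃ r > 0, ∃ u : κ → U,
      ((fun k => j (u k) - c₀) =O[l] fun k => ‖j (b k) - c₀‖ + ‖A k (b k) + D (F (j (b k)))‖) ∧
      Tendsto (fun k => j (u k)) l (𝓝 c₀) ∧
      ∀ᶠ k in l, u k ∈ Metric.closedBall (b k) r ∧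
        Metric.closedBall (b k) r ⊆ j ⁻¹' Metric.ball c₀ δ ∧
        ∀ v, j v ∈ Metric.ball c₀ δ → (A k v + D (F (j v)) = 0 ↔ v = u k) := by
  have hjb : Tendsto (fun k => j (b k)) l (𝓝 c₀) := by
    refine tendsto_of_limitGraph_unique (C := C) hj ?_ hc₀
      (tendsto_const_nhds.congr' (hb.mono fun k => .symm))
    exact (hA.and hC).mono fun k hk => norm_le_of_norm_inverse_le hk.1 hk.2
  have hres : Tendsto (fun k => A k (b k) + D (F (j (b k)))) l (𝓝 0) := by
    have h := (((D.continuous.tendsto _).comp hF.continuousAt).comp hjb).const_add (-D (F c₀))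
    rw [neg_add_cancel] at h
    exact h.congr' (hb.mono fun k hk => by simp only [Function.comp_apply, hk])
  obtain ⟨C', hC', hT⟩ :=
    exists_eventually_isInvertible_add hj hA hC (K := D ∘L dF) hdF
  obtain ⟨δ, hδ, r, hr, u, hub, hu⟩ := exists_zeros_of_approximate_zeros hF hC' hT hjb hres
  have herr := isBigO_map_sub_of_isBigO_sub j (c₀ := c₀) hub
  refine ⟨⟨C', hT⟩, δ, hδ, r, hr, u, herr, ?_, hu⟩
  rw [tendsto_iff_norm_sub_tendsto_zero] at hjb ⊢
  exact (herr.trans_tendsto (by simpa using hjb.add hres.norm)).norm.trans (by simp)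

end SemilinearEquation

section Poincare

section CompactSupport

variable {X F : Type*} [NormedAddCommGroup X] [NormedSpace ℝ X] [FiniteDimensional ℝ X]
  [MeasurableSpace X] [BorelSpace X] {μ : Measure X} [μ.IsAddHaarMeasure] [NormedAddCommGroup F]
  [InnerProductSpace ℝ F] {ψ : X → F}

theorem integral_mul_inner_fderiv_eq_neg_integral_norm_sq (hψ : ContDiff ℝ 1 ψ)
    (hψc : HasCompactSupport ψ) {ℓ : X →L[ℝ] ℝ} {v : X} (hv : ℓ v = 1) :
    ∫ x, 2 * ℓ x * inner ℝ (ψ x) (fderiv ℝ ψ x v) ∂μ = -∫ x, ‖ψ x‖ ^ 2 ∂μ := by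
  have hψ_cont := hψ.continuous
  have hdψ_cont : Continuous fun x => fderiv ℝ ψ x v :=
    (hψ.continuous_fderiv one_ne_zero).clm_apply continuous_const
  have hd_normSq (x : X) :
      ℓ x * fderiv ℝ (fun y => ‖ψ y‖ ^ 2) x v = 2 * ℓ x * inner ℝ (ψ x) (fderiv ℝ ψ x v) := by
    rw [(hψ.differentiable one_ne_zero x).hasFDerivAt.norm_sq.fderiv]
    simp only [smul_apply, ContinuousLinearMap.comp_apply, innerSL_apply_apply, nsmul_eq_mul,
      Nat.cast_ofNat]
    ring
  have integrable_of_continuous {g : X → ℝ} (hg : Continuous g) (h : ∀ x, ψ x = 0 → g x = 0) :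
      Integrable g μ :=
    hg.integrable_of_hasCompactSupport (hψc.mono fun x hx h0 => hx (h x h0))
  have hparts := integral_mul_fderiv_eq_neg_fderiv_mul_of_integrable (μ := μ) (f := ℓ)
    (g := fun x => ‖ψ x‖ ^ 2) (v := v)
    (by
      simp only [ℓ.fderiv, hv, one_mul]
      exact integrable_of_continuous (hψ_cont.norm.pow 2) fun x h => by simp [h])
    (by
      simp only [hd_normSq]
      exact integrable_of_continuous ((continuous_const.mul ℓ.continuous).mul
        (hψ_cont.inner hdψ_cont)) fun x h => by simp [h])
    (integrable_of_continuous (ℓ.continuous.mul (hψ_cont.norm.pow 2)) fun x h => by simp [h])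
    (fun x _ => ℓ.differentiableAt) fun x _ => (hψ.norm_sq ℝ).differentiable one_ne_zero x
  simpa only [hd_normSq, ℓ.fderiv, hv, one_mul] using hparts

/-- The functional `ℓ` replaces the usual primitive of `1` in the direction `v`. -/
theorem integral_norm_sq_le_integral_norm_fderiv_sq (hψ : ContDiff ℝ 1 ψ)
    (hψc : HasCompactSupport ψ) {ℓ : X →L[ℝ] ℝ} {v : X} (hv : ℓ v = 1) {R : ℝ}
    (hR : ∀ x ∈ tsupport ψ, |ℓ x| ≤ R) :
    ∫ x, ‖ψ x‖ ^ 2 ∂μ ≤ 4 * R ^ 2 * ∫ x, ‖fderiv ℝ ψ x v‖ ^ 2 ∂μ := by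
  have hψ_int : Integrable (fun x => ‖ψ x‖ ^ 2) μ :=
    (hψ.continuous.memLp_of_hasCompactSupport hψc).integrable_norm_pow two_ne_zero
  have hdψ_cont : Continuous fun x => fderiv ℝ ψ x v :=
    (hψ.continuous_fderiv one_ne_zero).clm_apply continuous_const
  have hdψ_int : Integrable (fun x => ‖fderiv ℝ ψ x v‖ ^ 2) μ :=
    (hdψ_cont.memLp_of_hasCompactSupport (hψc.fderiv_apply (𝕜 := ℝ) v)).integrable_norm_pow
      two_ne_zero
  have hcross_int : Integrable (fun x => 2 * ℓ x * inner ℝ (ψ x) (fderiv ℝ ψ x v)) μ :=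
    ((continuous_const.mul ℓ.continuous).mul
      (hψ.continuous.inner hdψ_cont)).integrable_of_hasCompactSupport
      (hψc.mono fun x hx h0 => hx (by simp [h0]))
  have young (x : X) : -(2 * ℓ x * inner ℝ (ψ x) (fderiv ℝ ψ x v)) ≤
      1 / 2 * ‖ψ x‖ ^ 2 + 2 * R ^ 2 * ‖fderiv ℝ ψ x v‖ ^ 2 := by
    by_cases hx : x ∈ tsupport ψ
    · have hsq := sq_nonneg ‖ψ x + (2 * ℓ x) • fderiv ℝ ψ x v‖
      rw [norm_add_sq_real, inner_smul_right, norm_smul, mul_pow, Real.norm_eq_abs, sq_abs] at hsq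
      have hℓR : ℓ x ^ 2 ≤ R ^ 2 := sq_le_sq.2 ((hR x hx).trans (le_abs_self R))
      nlinarith [mul_le_mul_of_nonneg_right hℓR (sq_nonneg ‖fderiv ℝ ψ x v‖)]
    · rw [image_eq_zero_of_notMem_tsupport hx, inner_zero_left, mul_zero, neg_zero]
      positivity
  have hle : ∫ x, ‖ψ x‖ ^ 2 ∂μ ≤
      1 / 2 * ∫ x, ‖ψ x‖ ^ 2 ∂μ + 2 * R ^ 2 * ∫ x, ‖fderiv ℝ ψ x v‖ ^ 2 ∂μ :=
    calc ∫ x, ‖ψ x‖ ^ 2 ∂μ = ∫ x, -(2 * ℓ x * inner ℝ (ψ x) (fderiv ℝ ψ x v)) ∂μ := by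
          rw [integral_neg, integral_mul_inner_fderiv_eq_neg_integral_norm_sq hψ hψc hv, neg_neg]
      _ ≤ ∫ x, 1 / 2 * ‖ψ x‖ ^ 2 + 2 * R ^ 2 * ‖fderiv ℝ ψ x v‖ ^ 2 ∂μ :=
          integral_mono hcross_int.neg ((hψ_int.const_mul _).add (hdψ_int.const_mul _)) young
      _ = _ := by
          rw [integral_add (hψ_int.const_mul _) (hdψ_int.const_mul _), integral_const_mul,
            integral_const_mul]
  linarith

end CompactSupport

theorem Lp_norm_sq_eq_integral {X F : Type*} [MeasurableSpace X] {μ : Measure X}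
    [NormedAddCommGroup F] [InnerProductSpace ℝ F] (u : Lp F 2 μ) :
    ‖u‖ ^ 2 = ∫ x, ‖u x‖ ^ 2 ∂μ := by
  rw [← real_inner_self_eq_norm_sq, L2.inner_def]
  simp only [real_inner_self_eq_norm_sq]

theorem Lp_integrable_norm_sq {X F : Type*} [MeasurableSpace X] {μ : Measure X}
    [NormedAddCommGroup F] (u : Lp F 2 μ) : Integrable (fun x => ‖u x‖ ^ 2) μ :=
  (Lp.memLp u).integrable_norm_pow two_ne_zero

variable {N n : ℕ} {Ω : Set (Sp N)}

theorem norm_fderiv_single_sq_le_norm_jac_sq (ψ : Sp N → Sp n) (i : Fin N) (x : Sp N) :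
    ‖fderiv ℝ ψ x (EuclideanSpace.single i 1)‖ ^ 2 ≤ ‖jac ψ x‖ ^ 2 := by
  rw [EuclideanSpace.real_norm_sq_eq, EuclideanSpace.real_norm_sq_eq, Fintype.sum_prod_type]
  exact Finset.sum_le_sum fun α _ => Finset.single_le_sum
    (f := fun i => jac ψ x (α, i) ^ 2) (fun _ _ => sq_nonneg _) (Finset.mem_univ i)

theorem norm_fst_sq_le_of_mem_testPairs (i : Fin N) {R : ℝ} (hR : ∀ x ∈ Ω, |x i| ≤ R)
    {z : WithLp 2 (LpVec Ω n 2 × LpGr Ω n 2)} (hz : z ∈ testPairs Ω n) :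
    ‖z.fst‖ ^ 2 ≤ 4 * R ^ 2 * ‖z.snd‖ ^ 2 := by
  obtain ⟨ψ, hψ, hψc, hψΩ, hfst, hsnd⟩ := hz
  have hnorm_fst : ‖z.fst‖ ^ 2 = ∫ x, ‖ψ x‖ ^ 2 :=
    calc ‖z.fst‖ ^ 2 = ∫ x in Ω, ‖ψ x‖ ^ 2 := by
          rw [Lp_norm_sq_eq_integral]
          exact integral_congr_ae (hfst.fun_comp fun y => ‖y‖ ^ 2)
      _ = ∫ x, ‖ψ x‖ ^ 2 := setIntegral_eq_integral_of_forall_compl_eq_zero fun x hx => by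
          simp [image_eq_zero_of_notMem_tsupport fun h => hx (hψΩ h)]
  have hnorm_snd : ∫ x, ‖fderiv ℝ ψ x (EuclideanSpace.single i 1)‖ ^ 2 ≤ ‖z.snd‖ ^ 2 := by
    rw [Lp_norm_sq_eq_integral, ← setIntegral_eq_integral_of_forall_compl_eq_zero (s := Ω)
      fun x hx => by
        simp [image_eq_zero_of_notMem_tsupport fun h => hx (hψΩ (tsupport_fderiv_subset ℝ h))]]
    refine integral_mono_of_nonneg (.of_forall fun x => sq_nonneg _) (Lp_integrable_norm_sq _) ?_
    filter_upwards [hsnd] with x hx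
    exact hx ▸ norm_fderiv_single_sq_le_norm_jac_sq ψ i x
  calc ‖z.fst‖ ^ 2 = ∫ x, ‖ψ x‖ ^ 2 := hnorm_fst
    _ ≤ 4 * R ^ 2 * ∫ x, ‖fderiv ℝ ψ x (EuclideanSpace.single i 1)‖ ^ 2 :=
      integral_norm_sq_le_integral_norm_fderiv_sq (hψ.of_le (by simp)) hψc
        (ℓ := EuclideanSpace.proj i) (by simp) fun x hx => hR x (hψΩ hx)
    _ ≤ 4 * R ^ 2 * ‖z.snd‖ ^ 2 := by gcongr

theorem norm_sq_le_norm_grad_sq (i : Fin N) {R : ℝ} (hR : ∀ x ∈ Ω, |x i| ≤ R) (u : W012 Ω n) :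
    ‖u‖ ^ 2 ≤ (4 * R ^ 2 + 1) * ‖grad Ω n u‖ ^ 2 := by
  have hfst := closure_minimal (fun z hz => norm_fst_sq_le_of_mem_testPairs i hR hz)
    (isClosed_le ((WithLp.fstL 2 ℝ (LpVec Ω n 2) (LpGr Ω n 2)).continuous.norm.pow 2)
      (((WithLp.sndL 2 ℝ (LpVec Ω n 2) (LpGr Ω n 2)).continuous.norm.pow 2).const_mul
        (4 * R ^ 2))) u.2
  calc ‖u‖ ^ 2 = ‖u.1.fst‖ ^ 2 + ‖u.1.snd‖ ^ 2 := WithLp.prod_norm_sq_eq_of_L2 u.1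
    _ ≤ 4 * R ^ 2 * ‖u.1.snd‖ ^ 2 + ‖u.1.snd‖ ^ 2 := by gcongr; exact hfst
    _ = (4 * R ^ 2 + 1) * ‖grad Ω n u‖ ^ 2 := by rw [add_mul, one_mul]; rfl

end Poincare

section opA

variable {N n : ℕ} {Ω : Set (Sp N)}

theorem integrable_flux_mul_grad (a : Tensor Ω n) (u φ : W012 Ω n) (α : Fin n) (i : Fin N) :
    Integrable (fun x => (∑ β, ∑ j, a α β i j x * grad Ω n u x (β, j)) * grad Ω n φ x (α, i))
      (volume.restrict Ω) := by
  refine (L2.integrable_inner (𝕜 := ℝ) (comp Ω n (α, i) (grad Ω n φ)) (flux a α i u)).congr ?_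
  filter_upwards [flux_ae a α i u, comp_ae (α, i) (grad Ω n φ)] with x hflux hcomp
  simp [hflux, hcomp]

theorem opA_eq_integral (a : Tensor Ω n) (u φ : W012 Ω n) :
    opA a u φ = ∫ x in Ω, ∑ α, ∑ i,
      (∑ β, ∑ j, a α β i j x * grad Ω n u x (β, j)) * grad Ω n φ x (α, i) := by
  rw [opA_apply, integral_finsetSum _ fun α _ => integrable_finsetSum _ fun i _ =>
    integrable_flux_mul_grad a u φ α i]
  exact Finset.sum_congr rfl fun α _ => (integral_finsetSum _ fun i _ =>
    integrable_flux_mul_grad a u φ α i).symm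

theorem IsLegendre.le_opA {c : ℝ} {a : Tensor Ω n} (ha : IsLegendre c a) (u : W012 Ω n) :
    c * ‖grad Ω n u‖ ^ 2 ≤ opA a u u := by
  rw [opA_eq_integral, Lp_norm_sq_eq_integral, ← integral_const_mul]
  refine integral_mono_ae ((Lp_integrable_norm_sq _).const_mul c)
    (integrable_finsetSum _ fun α _ => integrable_finsetSum _ fun i _ =>
      integrable_flux_mul_grad a u u α i) ?_
  filter_upwards [ha] with x hx
  rw [EuclideanSpace.real_norm_sq_eq, Fintype.sum_prod_type]
  refine (hx _).trans_eq (Finset.sum_congr rfl fun α _ => ?_)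
  rw [Finset.sum_comm]
  simp only [Finset.sum_mul, mul_right_comm]

theorem IsLegendre.coercive_opA {c : ℝ} (hc : 0 ≤ c) {a : Tensor Ω n} (ha : IsLegendre c a)
    (i : Fin N) {R : ℝ} (hR : ∀ x ∈ Ω, |x i| ≤ R) (u : W012 Ω n) :
    c / (4 * R ^ 2 + 1) * ‖u‖ ^ 2 ≤ opA a u u := by
  refine le_trans ?_ (ha.le_opA u)
  rw [div_mul_eq_mul_div, div_le_iff₀ (by positivity), mul_assoc, mul_comm (‖grad Ω n u‖ ^ 2)]
  exact mul_le_mul_of_nonneg_left (norm_sq_le_norm_grad_sq i hR u) hc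

theorem norm_eq_zero_of_surjective_opA {Ω : Set (Sp 0)} {ahat : Tensor Ω n}
    (hahat : Function.Surjective (opA ahat)) (u : W012 Ω n) : ‖u‖ = 0 := by
  obtain ⟨v, hv⟩ := hahat (innerSL ℝ u)
  have huu : innerSL ℝ u u = 0 := by rw [← hv]; simp [opA_apply]
  rwa [innerSL_apply_apply, inner_self_eq_zero, ← norm_eq_zero] at huu

/-- In dimension `N = 0`, where the Poincaré inequality fails, surjectivity forces
`W₀^{1,2} = 0`. -/
theorem exists_forall_isLegendre_coercive_opA (hΩ : Bornology.IsBounded Ω) {c : ℝ} (hc : 0 < c)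
    {ahat : Tensor Ω n} (hahat : Function.Surjective (opA ahat)) :
    ∃ c' > 0, ∀ a : Tensor Ω n, IsLegendre c a → ∀ u, c' * ‖u‖ ^ 2 ≤ opA a u u := by
  rcases N.eq_zero_or_pos with rfl | hN
  · refine ⟨1, one_pos, fun a _ u => ?_⟩
    simp [norm_eq_zero_of_surjective_opA hahat u, opA_apply]
  · obtain ⟨R, hR⟩ := hΩ.exists_norm_le
    exact ⟨c / (4 * R ^ 2 + 1), by positivity, fun a ha => ha.coercive_opA hc.le ⟨0, hN⟩
      fun x hx => (PiLp.norm_apply_le x _).trans (hR x hx)⟩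

theorem norm_comp_apply_le (k : Fin n × Fin N) (g : LpGr Ω n 2) : ‖comp Ω n k g‖ ≤ ‖g‖ := by
  refine Lp.norm_le_norm_of_ae_le ?_
  filter_upwards [comp_ae k g] with x hx
  exact hx ▸ PiLp.norm_apply_le (g x) k

theorem norm_grad_apply_le (u : W012 Ω n) : ‖grad Ω n u‖ ≤ ‖u‖ :=
  WithLp.norm_snd_le _ u.1

theorem norm_flux_apply_le {a : Tensor Ω n} {M : ℝ} (hM : ∀ α β i j, ‖a α β i j‖ ≤ M)
    (α : Fin n) (i : Fin N) (u : W012 Ω n) : ‖flux a α i u‖ ≤ n * N * M * ‖u‖ := by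
  have hterm (β : Fin n) (j : Fin N) :
      ‖((ContinuousLinearMap.mul ℝ ℝ).holderL (volume.restrict Ω) ∞ 2 2 (a α β i j))
        (comp Ω n (β, j) (grad Ω n u))‖ ≤ M * ‖u‖ := by
    refine ((ContinuousLinearMap.mul ℝ ℝ).norm_holder_apply_apply_le _ _).trans ?_
    rw [ContinuousLinearMap.opNorm_mul, one_mul]
    exact mul_le_mul (hM α β i j) ((norm_comp_apply_le _ _).trans (norm_grad_apply_le u))
      (norm_nonneg _) ((norm_nonneg _).trans (hM α β i j))
  calc ‖flux a α i u‖ ≤ ∑ _β : Fin n, ∑ _j : Fin N, M * ‖u‖ := by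
        simp only [flux, sum_apply]
        exact norm_sum_le_of_le _ fun β _ => norm_sum_le_of_le _ fun j _ => hterm β j
    _ = n * N * M * ‖u‖ := by simp [mul_assoc]

theorem norm_opA_apply_le {a : Tensor Ω n} {M : ℝ} (hM₀ : 0 ≤ M)
    (hM : ∀ α β i j, ‖a α β i j‖ ≤ M) (u : W012 Ω n) :
    ‖opA a u‖ ≤ (n * N) ^ 2 * M * ‖u‖ := by
  refine ContinuousLinearMap.opNorm_le_bound _ (by positivity) fun φ => ?_
  calc ‖opA a u φ‖ ≤ ∑ _α : Fin n, ∑ _i : Fin N, n * N * M * ‖u‖ * ‖φ‖ := by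
        simp only [opA, sum_apply]
        refine norm_sum_le_of_le _ fun α _ => norm_sum_le_of_le _ fun i _ => ?_
        refine (norm_inner_le_norm (flux a α i u) (comp Ω n (α, i) (grad Ω n φ))).trans ?_
        exact mul_le_mul (norm_flux_apply_le hM α i u)
          ((norm_comp_apply_le _ _).trans (norm_grad_apply_le φ)) (norm_nonneg _) (by positivity)
    _ = (n * N) ^ 2 * M * ‖u‖ * ‖φ‖ := by
        simp only [Finset.sum_const, Finset.card_univ, Fintype.card_fin, nsmul_eq_mul]
        ring

theorem exists_forall_coercive_opA_and_norm_le (hΩ : Bornology.IsBounded Ω) {a : ℝ → Tensor Ω n}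
    {ahat : Tensor Ω n} (ha_bdd : ∃ M : ℝ, ∀ ε > 0, ∀ α β i j, ‖a ε α β i j‖ ≤ M)
    (ha_leg : ∃ c > 0, ∀ ε > 0, IsLegendre c (a ε)) (hahat : Function.Surjective (opA ahat)) :
    ∃ c > 0, ∃ M : ℝ, ∀ ε > 0,
      (∀ u, c * ‖u‖ ^ 2 ≤ opA (a ε) u u) ∧ ∀ u, ‖opA (a ε) u‖ ≤ M * ‖u‖ := by
  obtain ⟨M, hM⟩ := ha_bdd
  obtain ⟨c, hc, hleg⟩ := ha_leg
  obtain ⟨c', hc', hcoer⟩ := exists_forall_isLegendre_coercive_opA hΩ hc hahat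
  exact ⟨c', hc', (n * N) ^ 2 * |M|, fun ε hε => ⟨hcoer _ (hleg ε hε),
    norm_opA_apply_le (abs_nonneg M) fun α β i j => (hM ε hε α β i j).trans (le_abs_self M)⟩⟩

theorem HConverges.gConverges (hΩ : Bornology.IsBounded Ω) {a : ℝ → Tensor Ω n}
    {ahat : Tensor Ω n} {c : ℝ} (hc : 0 < c) (ha_leg : ∀ ε > 0, IsLegendre c (a ε))
    (ha_H : HConverges a ahat) : GConverges (𝓝[>] 0) (fun ε => opA (a ε)) (opA ahat) := by
  obtain ⟨c', hc', hcoer⟩ := exists_forall_isLegendre_coercive_opA hΩ hc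
    fun φ => (ha_H φ).imp fun _ h => h.1
  intro φ
  obtain ⟨u, hu, hlim⟩ := ha_H φ
  exact ⟨u, hu, (hlim _ fun ε hε =>
    (isInvertible_of_coercive hc' (hcoer _ (ha_leg ε hε))).self_apply_inverse φ).1⟩

end opA

section W0C

variable {N n : ℕ} {Ω : Set (Sp N)}

theorem continuousOn_ext0 (v : CBar Ω n) : ContinuousOn (ext0 v) (closure Ω) := by
  rw [continuousOn_iff_continuous_domRestrict]
  have hext : (closure Ω).domRestrict (ext0 v) = v := funext fun x => ext0_apply v x
  exact hext ▸ v.continuous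

theorem norm_ext0_le (v : CBar Ω n) (x : Sp N) : ‖ext0 v x‖ ≤ ‖v‖ := by
  by_cases hx : x ∈ closure Ω
  · exact (congrArg norm (ext0_apply v ⟨x, hx⟩)).trans_le (v.norm_coe_le_norm _)
  · have hzero : ext0 v x = 0 := Function.extend_apply' _ _ _ (by rintro ⟨y, rfl⟩; exact hx y.2)
    rw [hzero, norm_zero]
    exact norm_nonneg _

theorem memLp_ext0 [IsFiniteMeasure (volume.restrict Ω)] (p : ℝ≥0∞) (v : CBar Ω n) :
    MemLp (ext0 v) p (volume.restrict Ω) :=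
  .of_bound (((continuousOn_ext0 v).aestronglyMeasurable
      isClosed_closure.measurableSet).mono_measure (Measure.restrict_mono subset_closure le_rfl))
    ‖v‖ (.of_forall (norm_ext0_le v))

/-- The restriction of continuous functions on `closure Ω` to elements of `L^2(Ω; ℝ^n)`. -/
noncomputable def ext0Lp (Ω : Set (Sp N)) (n : ℕ) [IsFiniteMeasure (volume.restrict Ω)] :
    CBar Ω n →L[ℝ] LpVec Ω n 2 :=
  LinearMap.mkContinuous
    { toFun := fun v => (memLp_ext0 2 v).toLp
      map_add' := fun v w => (MemLp.toLp_congr _ _ (ext0_add v w ▸ .rfl)).trans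
        (MemLp.toLp_add (memLp_ext0 2 v) (memLp_ext0 2 w))
      map_smul' := fun c v => (MemLp.toLp_congr _ _ (ext0_smul c v ▸ .rfl)).trans
        (MemLp.toLp_const_smul c (memLp_ext0 2 v)) }
    (measureUnivNNReal (volume.restrict Ω) ^ (2 : ℝ≥0∞).toReal⁻¹) fun v =>
      Lp.norm_le_of_ae_bound (norm_nonneg v) <| (memLp_ext0 2 v).coeFn_toLp.mono fun x hx =>
        (congrArg norm hx).trans_le (norm_ext0_le v x)

theorem mem_W0C_iff [IsFiniteMeasure (volume.restrict Ω)] {z : W012 Ω n × CBar Ω n} :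
    z ∈ W0C Ω n ↔ z.1.fn = ext0Lp Ω n z.2 :=
  ⟨fun h => Lp.ext (EventuallyEq.trans h (memLp_ext0 2 z.2).coeFn_toLp.symm),
    fun h => (congrArg (fun u : LpVec Ω n 2 => ⇑u) h).eventuallyEq.trans
      (memLp_ext0 2 z.2).coeFn_toLp⟩

theorem mem_W0C_of_tendsto [IsFiniteMeasure (volume.restrict Ω)] {X : Type*} {m : Filter X}
    [m.NeBot] {w : X → W0C Ω n} {u : W012 Ω n} {v : CBar Ω n}
    (hu : ∀ ψ : Wneg Ω n, Tendsto (fun k => ψ (toW Ω n (w k))) m (𝓝 (ψ u)))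
    (hv : Tendsto (fun k => toC Ω n (w k)) m (𝓝 v)) : (u, v) ∈ W0C Ω n := by
  refine mem_W0C_iff.2 (ext_inner_left ℝ fun h => ?_)
  have hweak := hu (innerSL ℝ h ∘L (WithLp.fstL 2 ℝ (LpVec Ω n 2) (LpGr Ω n 2)) ∘L
    (testPairs Ω n).topologicalClosure.subtypeL)
  have hstrong := ((innerSL ℝ h ∘L ext0Lp Ω n).continuous.tendsto v).comp hv
  exact tendsto_nhds_unique hweak
    (hstrong.congr fun k => congrArg (inner ℝ h) (mem_W0C_iff.1 (w k).2).symm)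

theorem toW_injective (hΩ : IsOpen Ω) : Function.Injective (toW Ω n) := by
  rintro ⟨⟨u, v⟩, hv⟩ ⟨⟨u', w⟩, hw⟩ (rfl : u = u')
  have hΩ_eq : EqOn (ext0 v) (ext0 w) Ω :=
    Measure.eqOn_open_of_ae_eq (EventuallyEq.trans (EventuallyEq.symm hv) hw) hΩ
      ((continuousOn_ext0 v).mono subset_closure) ((continuousOn_ext0 w).mono subset_closure)
  have hclosure_eq : EqOn (ext0 v) (ext0 w) (closure Ω) :=
    hΩ_eq.of_subset_closure (continuousOn_ext0 v) (continuousOn_ext0 w) subset_closure subset_rfl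
  congr 2
  ext1 x
  rw [← ext0_apply, ← ext0_apply, hclosure_eq x.2]

theorem norm_le_supNorm (v : CBar Ω n) : ‖v‖ ≤ supNorm v := by
  have hbdd (α : Fin n) : BddAbove (range fun x => |v x α|) :=
    ⟨‖v‖, by rintro _ ⟨x, rfl⟩; exact (PiLp.norm_apply_le (v x) α).trans (v.norm_coe_le_norm x)⟩
  refine (BoundedContinuousFunction.norm_le
    (Finset.sum_nonneg fun α _ => Real.iSup_nonneg fun x => abs_nonneg _)).2 fun x => ?_
  calc ‖v x‖ ≤ ∑ α, |v x α| := by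
        rw [EuclideanSpace.norm_eq]
        refine Real.sqrt_le_iff.2 ⟨by positivity, ?_⟩
        simp only [Real.norm_eq_abs]
        exact Finset.sum_sq_le_sq_sum_of_nonneg fun α _ => abs_nonneg _
    _ ≤ supNorm v := Finset.sum_le_sum fun α _ => le_ciSup (hbdd α) x

theorem supNorm_le (v : CBar Ω n) : supNorm v ≤ n * ‖v‖ := by
  calc supNorm v ≤ ∑ _α : Fin n, ‖v‖ := Finset.sum_le_sum fun α _ =>
        Real.iSup_le (fun x => (PiLp.norm_apply_le (v x) α).trans (v.norm_coe_le_norm x))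
          (norm_nonneg _)
    _ = n * ‖v‖ := by simp

theorem supNorm_nonneg (v : CBar Ω n) : 0 ≤ supNorm v :=
  (norm_nonneg v).trans (norm_le_supNorm v)

theorem isBigO_supNorm_of_isBigO_norm {X κ : Type*} [SeminormedAddCommGroup X] {l : Filter κ}
    {u b : κ → CBar Ω n} {g : κ → X} (h : u =O[l] fun k => ‖b k‖ + ‖g k‖) :
    (fun k => supNorm (u k)) =O[l] fun k => supNorm (b k) + ‖g k‖ := by
  have hu : (fun k => supNorm (u k)) =O[l] u := .of_bound n <| .of_forall fun k => by
    simpa only [Real.norm_of_nonneg (supNorm_nonneg _)] using supNorm_le (u k)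
  refine (hu.trans h).trans (.of_norm_le fun k => ?_)
  rw [Real.norm_of_nonneg (by positivity)]
  exact add_le_add_left (norm_le_supNorm _) _

theorem tendsto_supNorm_sub {κ : Type*} {l : Filter κ} {u : κ → CBar Ω n} {v : CBar Ω n}
    (h : Tendsto u l (𝓝 v)) : Tendsto (fun k => supNorm (u k - v)) l (𝓝 0) :=
  squeeze_zero (fun _ => supNorm_nonneg _) (fun _ => supNorm_le _) <| by
    simpa only [mul_zero] using (tendsto_iff_norm_sub_tendsto_zero.1 h).const_mul (n : ℝ)

end W0C

section WeakSolution

variable {N n : ℕ} {Ω : Set (Sp N)}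

theorem integrable_mul_grad [IsFiniteMeasure (volume.restrict Ω)] {p : ℝ≥0∞} (hp : 2 ≤ p)
    {g : Sp N → Gr n N} (hg : MemLp g p (volume.restrict Ω)) (φ : W012 Ω n) (α : Fin n)
    (i : Fin N) :
    Integrable (fun x => g x (α, i) * grad Ω n φ x (α, i)) (volume.restrict Ω) :=
  ((EuclideanSpace.proj (α, i) : Gr n N →L[ℝ] ℝ).comp_memLp' (hg.mono_exponent hp)).integrable_mul
    ((EuclideanSpace.proj (α, i) : Gr n N →L[ℝ] ℝ).comp_memLp' (Lp.memLp (grad Ω n φ)))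

theorem isWeakSolution_iff_pairD [IsFiniteMeasure (volume.restrict Ω)] (a : Tensor Ω n)
    {f : Fin n → Fin N → Sp N → Sp n → ℝ} {p : ℝ≥0∞} (hp : 2 ≤ p)
    (hf : ∀ v : CBar Ω n, MemLp (superpos f v) p (volume.restrict Ω)) (u : W0C Ω n) :
    IsWeakSolution a f u ↔
      ∀ φ, opA a (toW Ω n u) φ + pairD (opF f p hf (toC Ω n u)) φ = 0 := by
  refine forall_congr' fun φ => ?_
  have hpair : pairD (opF f p hf (toC Ω n u)) φ = ∫ x in Ω, ∑ α, ∑ i,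
      f α i x (ext0 (toC Ω n u) x) * grad Ω n φ x (α, i) := by
    refine integral_congr_ae ?_
    filter_upwards [(hf (toC Ω n u)).coeFn_toLp] with x hx
    simp only [opF, hx, superpos]
  rw [hpair, opA_eq_integral, ← integral_add]
  · simp only [add_mul, Finset.sum_add_distrib]
  · exact integrable_finsetSum _ fun α _ => integrable_finsetSum _ fun i _ =>
      integrable_flux_mul_grad a _ φ α i
  · exact integrable_finsetSum _ fun α _ => integrable_finsetSum _ fun i _ =>
      integrable_mul_grad hp (hf (toC Ω n u)) φ α i

variable {U V : Type*} [NormedAddCommGroup V]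

theorem apply_toW_eq_iff_exists_add_eq_zero (hΩ : IsOpen Ω) {B : W012 Ω n → Wneg Ω n}
    (hB : Function.Injective B) {κ : V → Wneg Ω n} {ι : U → W0C Ω n} {A : U → V}
    (hA : ∀ u, κ (A u) = B (toW Ω n (ι u))) (hA_surj : Function.Surjective A)
    {K : CBar Ω n → V} {u : W0C Ω n} :
    B (toW Ω n u) = κ (-K (toC Ω n u)) ↔ ∃ w, ι w = u ∧ A w + K (toC Ω n (ι w)) = 0 := by
  constructor
  · intro hu
    obtain ⟨w, hw⟩ := hA_surj (-K (toC Ω n u))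
    have hwu : ι w = u := toW_injective hΩ <| hB <| by rw [← hA, hw, ← hu]
    exact ⟨w, hwu, by rw [hwu, hw, neg_add_cancel]⟩
  · rintro ⟨w, rfl, hw⟩
    rw [← hA, eq_neg_of_add_eq_zero_left hw]

theorem mem_and_apply_toW_eq_iff (hΩ : IsOpen Ω) {B : W012 Ω n → Wneg Ω n}
    (hB : Function.Injective B) {κ : V → Wneg Ω n} {ι : U → W0C Ω n} {A : U → V}
    (hA : ∀ u, κ (A u) = B (toW Ω n (ι u))) (hA_surj : Function.Surjective A)
    {K : CBar Ω n → V} {s : Set (CBar Ω n)} {u : U} (hus : toC Ω n (ι u) ∈ s)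
    (hu : ∀ v, toC Ω n (ι v) ∈ s → (A v + K (toC Ω n (ι v)) = 0 ↔ v = u)) {v : W0C Ω n} :
    toC Ω n v ∈ s ∧ B (toW Ω n v) = κ (-K (toC Ω n v)) ↔ v = ι u := by
  rw [apply_toW_eq_iff_exists_add_eq_zero hΩ hB hA hA_surj]
  constructor
  · rintro ⟨hws, w, rfl, hw⟩
    rw [(hu w hws).1 hw]
  · rintro rfl
    exact ⟨hus, u, rfl, (hu u hus).2 rfl⟩

variable [NormedSpace ℝ V]

theorem eq_map_neg_iff_forall_pairD {p : ℝ≥0∞} [Fact (1 ≤ p)] {κ : V →L[ℝ] Wneg Ω n}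
    {D : LpGr Ω n p →L[ℝ] V} (hD : ∀ g φ, κ (D g) φ = pairD g φ) {w : Wneg Ω n}
    {g : LpGr Ω n p} : w = κ (-D g) ↔ ∀ φ, w φ + pairD g φ = 0 := by
  rw [map_neg, eq_neg_iff_add_eq_zero, ContinuousLinearMap.ext_iff]
  simp only [add_apply, hD, zero_apply]

theorem isWeakSolution_iff_opA_eq [IsFiniteMeasure (volume.restrict Ω)] (a : Tensor Ω n)
    {f : Fin n → Fin N → Sp N → Sp n → ℝ} {p : ℝ≥0∞} [Fact (1 ≤ p)] (hp : 2 ≤ p)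
    (hf : ∀ v : CBar Ω n, MemLp (superpos f v) p (volume.restrict Ω))
    {κ : V →L[ℝ] Wneg Ω n} {D : LpGr Ω n p →L[ℝ] V} (hD : ∀ g φ, κ (D g) φ = pairD g φ)
    (u : W0C Ω n) :
    IsWeakSolution a f u ↔ opA a (toW Ω n u) = κ (-D (opF f p hf (toC Ω n u))) :=
  (isWeakSolution_iff_pairD a hp hf u).trans (eq_map_neg_iff_forall_pairD hD).symm

theorem exists_W0C_of_mem_limitGraph [IsFiniteMeasure (volume.restrict Ω)] {X : Type*}
    {l : Filter X} [l.NeBot] {B : X → W012 Ω n →L[ℝ] Wneg Ω n} {Bhat : W012 Ω n →L[ℝ] Wneg Ω n}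
    (hG : GConverges l B Bhat) {c M : ℝ} (hc : 0 < c)
    (hB : ∀ᶠ k in l, ∀ u, c * ‖u‖ ^ 2 ≤ B k u u) (hM : ∀ᶠ k in l, ∀ u, ‖B k u‖ ≤ M * ‖u‖)
    {ι : U → W0C Ω n} {κ : V →L[ℝ] Wneg Ω n} {A : X → U → V}
    (hA : ∀ᶠ k in l, ∀ u, κ (A k u) = B k (toW Ω n (ι u))) {v : CBar Ω n} {g : V}
    (hvg : (v, g) ∈ limitGraph l (fun u => toC Ω n (ι u)) A) :
    ∃ z : W0C Ω n, toC Ω n z = v ∧ Bhat (toW Ω n z) = κ g := by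
  obtain ⟨m, hm, hv, hg⟩ := mem_limitGraph_iff_ultrafilter.1 hvg
  obtain ⟨u, hu, -⟩ := hG (κ g)
  have hBw : Tendsto (fun q : X × U => B q.1 (toW Ω n (ι q.2))) m (𝓝 (Bhat u)) := by
    rw [hu]
    exact ((κ.continuous.tendsto g).comp hg).congr' ((hm.eventually hA).mono fun q hq => hq q.2)
  exact ⟨⟨(u, v), mem_W0C_of_tendsto (hG.tendsto_of_tendsto_apply hc hB hM hm hBw) hv⟩, rfl, hu⟩

theorem eq_toC_of_mem_limitGraph (hΩ : IsOpen Ω) [IsFiniteMeasure (volume.restrict Ω)]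
    {X : Type*} {l : Filter X} [l.NeBot] {B : X → W012 Ω n →L[ℝ] Wneg Ω n}
    {Bhat : W012 Ω n →L[ℝ] Wneg Ω n} (hG : GConverges l B Bhat) {c M : ℝ} (hc : 0 < c)
    (hB : ∀ᶠ k in l, ∀ u, c * ‖u‖ ^ 2 ≤ B k u u) (hM : ∀ᶠ k in l, ∀ u, ‖B k u‖ ≤ M * ‖u‖)
    {ι : U → W0C Ω n} {κ : V →L[ℝ] Wneg Ω n} {A : X → U → V}
    (hA : ∀ᶠ k in l, ∀ u, κ (A k u) = B k (toW Ω n (ι u))) {u₀ : W0C Ω n} {g : V}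
    (hu₀ : Bhat (toW Ω n u₀) = κ g) {v : CBar Ω n}
    (hvg : (v, g) ∈ limitGraph l (fun u => toC Ω n (ι u)) A) : v = toC Ω n u₀ := by
  obtain ⟨z, rfl, hz⟩ := exists_W0C_of_mem_limitGraph hG hc hB hM hA hvg
  rw [toW_injective hΩ (hG.injective hc hB hM (hz.trans hu₀.symm))]

theorem eq_zero_of_mem_limitGraph [IsFiniteMeasure (volume.restrict Ω)] {X : Type*}
    {l : Filter X} [l.NeBot] {B : X → W012 Ω n →L[ℝ] Wneg Ω n} {Bhat : W012 Ω n →L[ℝ] Wneg Ω n}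
    (hG : GConverges l B Bhat) {c M : ℝ} (hc : 0 < c)
    (hB : ∀ᶠ k in l, ∀ u, c * ‖u‖ ^ 2 ≤ B k u u) (hM : ∀ᶠ k in l, ∀ u, ‖B k u‖ ≤ M * ‖u‖)
    {ι : U → W0C Ω n} {κ : V →L[ℝ] Wneg Ω n} {A : X → U → V}
    (hA : ∀ᶠ k in l, ∀ u, κ (A k u) = B k (toW Ω n (ι u))) {K : CBar Ω n → V}
    (hK : ∀ z : W0C Ω n, Bhat (toW Ω n z) = κ (K (toC Ω n z)) → z = 0) {v : CBar Ω n}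
    (hv : (v, K v) ∈ limitGraph l (fun u => toC Ω n (ι u)) A) : v = 0 := by
  obtain ⟨z, rfl, hz⟩ := exists_W0C_of_mem_limitGraph hG hc hB hM hA hv
  rw [hK z hz, map_zero]

theorem exists_zeros_of_gConverges (hΩ : IsOpen Ω) [IsFiniteMeasure (volume.restrict Ω)]
    {U L X : Type*} [NormedAddCommGroup U] [NormedSpace ℝ U] [CompleteSpace U]
    [NormedAddCommGroup L] [NormedSpace ℝ L] {l : Filter X} [l.NeBot]
    {B : X → W012 Ω n →L[ℝ] Wneg Ω n} {Bhat : W012 Ω n →L[ℝ] Wneg Ω n}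
    (hG : GConverges l B Bhat) {c M C : ℝ} (hc : 0 < c)
    (hB : ∀ᶠ k in l, ∀ u, c * ‖u‖ ^ 2 ≤ B k u u) (hM : ∀ᶠ k in l, ∀ u, ‖B k u‖ ≤ M * ‖u‖)
    {ι : U →L[ℝ] W0C Ω n} (hι : IsCompactOperator (toC Ω n ∘L ι)) {κ : V →L[ℝ] Wneg Ω n}
    {A : X → U →L[ℝ] V} (hA : ∀ᶠ k in l, ∀ u, κ (A k u) = B k (toW Ω n (ι u)))
    (hA_inv : ∀ᶠ k in l, (A k).IsInvertible) (hC : ∀ᶠ k in l, ‖(A k).inverse‖ ≤ C)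
    {D : L →L[ℝ] V} {F : CBar Ω n → L} {dF : CBar Ω n →L[ℝ] L} {u₀ : W0C Ω n}
    (hF : HasStrictFDerivAt F dF (toC Ω n u₀))
    (hu₀ : Bhat (toW Ω n u₀) = κ (-D (F (toC Ω n u₀))))
    (hdF : ∀ z : W0C Ω n, Bhat (toW Ω n z) = κ (-D (dF (toC Ω n z))) → z = 0)
    {b : X → U} (hb : ∀ᶠ k in l, A k (b k) = -D (F (toC Ω n u₀))) :
    (∃ C' : ℝ, ∀ᶠ k in l, (A k + D ∘L dF ∘L toC Ω n ∘L ι).IsInvertible ∧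
      ‖(A k + D ∘L dF ∘L toC Ω n ∘L ι).inverse‖ ≤ C') ∧
    ∃ δ > 0, ∃ r > 0, ∃ u : X → U,
      ((fun k => toC Ω n (ι (u k)) - toC Ω n u₀) =O[l] fun k =>
        ‖toC Ω n (ι (b k)) - toC Ω n u₀‖ + ‖A k (b k) + D (F (toC Ω n (ι (b k))))‖) ∧
      Tendsto (fun k => toC Ω n (ι (u k))) l (𝓝 (toC Ω n u₀)) ∧
      ∀ᶠ k in l, u k ∈ Metric.closedBall (b k) r ∧
        Metric.closedBall (b k) r ⊆ (toC Ω n ∘L ι) ⁻¹' Metric.ball (toC Ω n u₀) δ ∧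
        ∀ v, toC Ω n (ι v) ∈ Metric.ball (toC Ω n u₀) δ →
          (A k v + D (F (toC Ω n (ι v))) = 0 ↔ v = u k) :=
  exists_zeros_of_limitGraph_unique hι hA_inv hC hF
    (fun _ => eq_toC_of_mem_limitGraph hΩ hG hc hB hM hA hu₀)
    (fun _ => eq_zero_of_mem_limitGraph hG hc hB hM hA (K := fun v => -D (dF v)) hdF) hb

end WeakSolution

section FixMap

variable {N n : ℕ} {Ω : Set (Sp N)} {p : ℝ≥0∞} [Fact (1 ≤ p)] {U V : Type*}
  [NormedAddCommGroup U] [NormedSpace ℝ U] [NormedAddCommGroup V] [NormedSpace ℝ V]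
  {A : U →L[ℝ] V} {D : LpGr Ω n p →L[ℝ] V} {F : CBar Ω n → LpGr Ω n p} {c₀ : CBar Ω n}

theorem apply_approxSol (hA : A.IsInvertible) : A (approxSol A D F c₀) = -D (F c₀) := by
  rw [approxSol, map_neg, hA.self_apply_inverse]

variable {j : U →L[ℝ] CBar Ω n}

theorem fixMap_eq_self_iff (hT : (linOp A D (fderiv ℝ F c₀) j).IsInvertible) {u : U} :
    fixMap A D F c₀ j u = u ↔ A u + D (F (j u)) = 0 :=
  sub_eq_self.trans (map_eq_zero_iff _ hT.inverse.injective)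

theorem mem_and_fixMap_eq_self_iff (hT : (linOp A D (fderiv ℝ F c₀) j).IsInvertible) {s : Set U}
    {u : U} (hus : u ∈ s) (hu : ∀ v ∈ s, A v + D (F (j v)) = 0 ↔ v = u) {v : U} :
    v ∈ s ∧ fixMap A D F c₀ j v = v ↔ v = u := by
  rw [fixMap_eq_self_iff hT]
  exact ⟨fun h => (hu v h.1).1 h.2, fun h => h ▸ ⟨hus, (hu u hus).2 rfl⟩⟩

theorem exists_fixedPoints_of_gConverges (hΩ : IsOpen Ω) [IsFiniteMeasure (volume.restrict Ω)]
    [CompleteSpace U] {X : Type*} {l : Filter X} [l.NeBot]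
    {B : X → W012 Ω n →L[ℝ] Wneg Ω n} {Bhat : W012 Ω n →L[ℝ] Wneg Ω n}
    (hG : GConverges l B Bhat) {c M C : ℝ} (hc : 0 < c)
    (hB : ∀ᶠ k in l, ∀ u, c * ‖u‖ ^ 2 ≤ B k u u) (hM : ∀ᶠ k in l, ∀ u, ‖B k u‖ ≤ M * ‖u‖)
    {ι : U →L[ℝ] W0C Ω n} (hι : IsCompactOperator (toC Ω n ∘L ι)) {κ : V →L[ℝ] Wneg Ω n}
    {A : X → U →L[ℝ] V} (hA : ∀ᶠ k in l, ∀ u, κ (A k u) = B k (toW Ω n (ι u)))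
    (hA_inv : ∀ᶠ k in l, (A k).IsInvertible) (hC : ∀ᶠ k in l, ‖(A k).inverse‖ ≤ C)
    {u₀ : W0C Ω n} (hF : HasStrictFDerivAt F (fderiv ℝ F (toC Ω n u₀)) (toC Ω n u₀))
    (hu₀ : Bhat (toW Ω n u₀) = κ (-D (F (toC Ω n u₀))))
    (hdF : ∀ z : W0C Ω n,
      Bhat (toW Ω n z) = κ (-D (fderiv ℝ F (toC Ω n u₀) (toC Ω n z))) → z = 0) :
    (∃ C' : ℝ, ∀ᶠ k in l,
      (linOp (A k) D (fderiv ℝ F (toC Ω n u₀)) (toC Ω n ∘L ι)).IsInvertible ∧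
      ‖(linOp (A k) D (fderiv ℝ F (toC Ω n u₀)) (toC Ω n ∘L ι)).inverse‖ ≤ C') ∧
    ∃ r > 0, ∃ δ > 0, ∃ u : X → U,
      ((fun k => supNorm (toC Ω n (ι (u k)) - toC Ω n u₀)) =O[l] fun k =>
        supNorm (toC Ω n (ι (approxSol (A k) D F (toC Ω n u₀))) - toC Ω n u₀) +
        ‖A k (approxSol (A k) D F (toC Ω n u₀)) +
          D (F (toC Ω n (ι (approxSol (A k) D F (toC Ω n u₀)))))‖) ∧
      ∀ᶠ k in l,
        (∀ v, ‖v - approxSol (A k) D F (toC Ω n u₀)‖ ≤ r ∧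
          fixMap (A k) D F (toC Ω n u₀) (toC Ω n ∘L ι) v = v ↔ v = u k) ∧
        (∀ v, supNorm (toC Ω n (ι v) - toC Ω n u₀) < δ ∧
          fixMap (A k) D F (toC Ω n u₀) (toC Ω n ∘L ι) v = v ↔ v = u k) ∧
        ∀ v, supNorm (toC Ω n v - toC Ω n u₀) < δ ∧
          B k (toW Ω n v) = κ (-D (F (toC Ω n v))) ↔ v = ι (u k) := by
  obtain ⟨⟨C', hT⟩, δ, hδ, r, hr, u, herr, hlim, hu⟩ :=
    exists_zeros_of_gConverges hΩ hG hc hB hM hι hA hA_inv hC hF hu₀ hdF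
      (hA_inv.mono fun k hk => apply_approxSol hk)
  refine ⟨⟨C', hT⟩, r, hr, δ, hδ, u, isBigO_supNorm_of_isBigO_norm herr, ?_⟩
  filter_upwards [hB, hA, hA_inv, hT, hu, (tendsto_supNorm_sub hlim).eventually_lt_const hδ]
    with k hBk hAk hAk_inv hTk hk hsup
  obtain ⟨huk, hball, huniq⟩ := hk
  have huniq_sup {v : U} (hv : supNorm (toC Ω n (ι v) - toC Ω n u₀) < δ) :
      A k v + D (F (toC Ω n (ι v))) = 0 ↔ v = u k :=
    huniq v (mem_ball_iff_norm.2 ((norm_le_supNorm _).trans_lt hv))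
  refine ⟨fun v => ?_, fun v => ?_, fun v => ?_⟩
  · rw [← mem_closedBall_iff_norm]
    exact mem_and_fixMap_eq_self_iff hTk.1 huk fun v hv => huniq v (hball hv)
  · exact mem_and_fixMap_eq_self_iff (s := {v | supNorm (toC Ω n (ι v) - toC Ω n u₀) < δ})
      hTk.1 hsup fun v hv => huniq_sup hv
  · exact mem_and_apply_toW_eq_iff (s := {v | supNorm (v - toC Ω n u₀) < δ}) hΩ
      (isInvertible_of_coercive hc hBk).injective hAk hAk_inv.surjective hsup
      (K := fun v => D (F v)) fun v hv => huniq_sup hv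

end FixMap

theorem exists_forall_mem_Ioc_of_eventually_nhdsGT {P : ℝ → Prop} {x : ℝ}
    (h : ∀ᶠ ε in 𝓝[>] x, P ε) : ∃ y > x, ∀ ε ∈ Ioc x y, P ε :=
  mem_nhdsGT_iff_exists_Ioc_subset.1 h

end Homog

set_option maxHeartbeats 400000 in
-- each destructuring step rechecks the long goal, whose types unfold to closed subspaces of `Lp`
theorem mainTheorem2_general {N n : ℕ} {Ω : Set (Sp N)} (hΩ : IsOpen Ω)
    (hΩ_bdd : Bornology.IsBounded Ω) (a : ℝ → Tensor Ω n) (ahat : Tensor Ω n)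
    (ha_bdd : ∃ M : ℝ, ∀ ε > 0, ∀ α β i j, ‖a ε α β i j‖ ≤ M)
    (ha_leg : ∃ c > 0, ∀ ε > 0, IsLegendre c (a ε))
    (ha_G : GConverges (𝓝[>] 0) (fun ε => opA (a ε)) (opA ahat))
    (f : Fin n → Fin N → Sp N → Sp n → ℝ) (p₀ : ℝ≥0∞) [Fact (1 ≤ p₀)] (hp₀ : 2 ≤ p₀)
    (hf : ∀ v : CBar Ω n, MemLp (superpos f v) p₀ (volume.restrict Ω))
    (u₀ : W0C Ω n)
    (hF : HasStrictFDerivAt (opF f p₀ hf) (fderiv ℝ (opF f p₀ hf) (toC Ω n u₀)) (toC Ω n u₀))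
    (hu₀ : IsWeakSolution ahat f u₀)
    (hu₀_nondeg : ∀ u : W0C Ω n,
      (∀ φ : W012 Ω n, opA ahat (toW Ω n u) φ +
        pairD (fderiv ℝ (opF f p₀ hf) (toC Ω n u₀) (toC Ω n u)) φ = 0) → u = 0)
    {U V : Type*} [NormedAddCommGroup U] [NormedSpace ℝ U] [CompleteSpace U]
    [NormedAddCommGroup V] [NormedSpace ℝ V] [CompleteSpace V]
    (ι : U →L[ℝ] W0C Ω n) (hι_cpt : IsCompactOperator (toC Ω n ∘L ι)) (κ : V →L[ℝ] Wneg Ω n)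
    (A : ℝ → U →L[ℝ] V) (hA : ∀ ε > 0, ∀ u, κ (A ε u) = opA (a ε) (toW Ω n (ι u)))
    (D : LpGr Ω n p₀ →L[ℝ] V) (hD : ∀ g φ, κ (D g) φ = pairD g φ)
    (hA_bij : ∀ ε > 0, Function.Bijective (A ε))
    (hA_inv : ∃ C : ℝ, ∀ ε > 0, ‖(A ε).inverse‖ ≤ C) :
    ∃ ε₀ > 0,
      (∀ ε ∈ Ioc 0 ε₀, Function.Bijective
        (linOp (A ε) D (fderiv ℝ (opF f p₀ hf) (toC Ω n u₀)) (toC Ω n ∘L ι))) ∧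
      (∃ C : ℝ, ∀ ε ∈ Ioc 0 ε₀,
        ‖(linOp (A ε) D (fderiv ℝ (opF f p₀ hf) (toC Ω n u₀)) (toC Ω n ∘L ι)).inverse‖ ≤ C) ∧
      ∃ r₀ > 0, ∃ ε₁ ∈ Ioc 0 ε₀, ∃ uε : ℝ → U,
        (∀ ε ∈ Ioc 0 ε₁, ∀ u : U,
          (‖u - approxSol (A ε) D (opF f p₀ hf) (toC Ω n u₀)‖ ≤ r₀ ∧
            fixMap (A ε) D (opF f p₀ hf) (toC Ω n u₀) (toC Ω n ∘L ι) u = u) ↔ u = uε ε) ∧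
        ((fun ε => supNorm (toC Ω n (ι (uε ε)) - toC Ω n u₀)) =O[𝓝[>] 0] fun ε =>
          supNorm (toC Ω n (ι (approxSol (A ε) D (opF f p₀ hf) (toC Ω n u₀))) - toC Ω n u₀) +
          ‖A ε (approxSol (A ε) D (opF f p₀ hf) (toC Ω n u₀)) +
            D (opF f p₀ hf (toC Ω n (ι (approxSol (A ε) D (opF f p₀ hf) (toC Ω n u₀)))))‖) ∧
        ∃ δ > 0, ∃ ε₂ ∈ Ioc 0 ε₁, ∀ ε ∈ Ioc 0 ε₂,
          (∀ u : U, (supNorm (toC Ω n (ι u) - toC Ω n u₀) < δ ∧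
            fixMap (A ε) D (opF f p₀ hf) (toC Ω n u₀) (toC Ω n ∘L ι) u = u) ↔ u = uε ε) ∧
          (∀ u : W0C Ω n, (supNorm (toC Ω n u - toC Ω n u₀) < δ ∧
            IsWeakSolution (a ε) f u) ↔ u = ι (uε ε)) := by
  have : IsFiniteMeasure (volume.restrict Ω) :=
    isFiniteMeasure_restrict.2 hΩ_bdd.measure_lt_top.ne
  obtain ⟨C, hC⟩ := hA_inv
  obtain ⟨c, hc, M, hcM⟩ := exists_forall_coercive_opA_and_norm_le hΩ_bdd ha_bdd ha_leg
    fun φ => (ha_G φ).imp fun _ h => h.1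
  have hpos : ∀ᶠ ε : ℝ in 𝓝[>] 0, 0 < ε := self_mem_nhdsWithin
  obtain ⟨⟨C', hT⟩, r, hr, δ, hδ, u, herr, hu⟩ :=
    exists_fixedPoints_of_gConverges hΩ ha_G hc (hpos.mono fun ε hε => (hcM ε hε).1)
      (hpos.mono fun ε hε => (hcM ε hε).2) hι_cpt (hpos.mono hA)
      (hpos.mono fun ε hε => isInvertible_of_bijective (hA_bij ε hε)) (hpos.mono hC) hF
      ((isWeakSolution_iff_opA_eq ahat hp₀ hf hD u₀).1 hu₀)
      fun z hz => hu₀_nondeg z ((eq_map_neg_iff_forall_pairD hD).1 hz)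
  obtain ⟨ε₀, hε₀, h⟩ := exists_forall_mem_Ioc_of_eventually_nhdsGT (hT.and hu)
  refine ⟨ε₀, hε₀, fun ε hε => (h ε hε).1.1.bijective, ⟨C', fun ε hε => (h ε hε).1.2⟩,
    r, hr, ε₀, ⟨hε₀, le_rfl⟩, u, fun ε hε => (h ε hε).2.1, herr,
    δ, hδ, ε₀, ⟨hε₀, le_rfl⟩, fun ε hε => ⟨(h ε hε).2.2.1, fun v => ?_⟩⟩
  rw [isWeakSolution_iff_opA_eq (a ε) hp₀ hf hD]
  exact (h ε hε).2.2.2 v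

theorem mainTheorem2 {N n : ℕ} {Ω : Set (Sp N)} (hΩ : IsBoundedLipschitzDomain Ω)
    -- the diffusion tensors and their H-limit
    (a : ℝ → Tensor Ω n) (ahat : Tensor Ω n)
    (ha_bdd : ∃ M : ℝ, ∀ ε > 0, ∀ α β i j, ‖a ε α β i j‖ ≤ M)
    (ha_leg : ∃ c > 0, ∀ ε > 0, IsLegendre c (a ε))
    (ha_H : HConverges a ahat)
    -- the nonlinearity
    (f : Fin n → Fin N → Sp N → Sp n → ℝ) (p₀ : ℝ≥0∞) [Fact (1 ≤ p₀)]
    (hp₀ : 2 ≤ p₀) (hNp₀ : (N : ℝ≥0∞) < p₀)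
    (hf : ∀ v : CBar Ω n, MemLp (superpos f v) p₀ (volume.restrict Ω))
    (hF : ContDiff ℝ 1 (opF f p₀ hf))
    -- the nondegenerate weak solution of the homogenized problem
    (u₀ : W0C Ω n) (hu₀ : IsWeakSolution ahat f u₀)
    (hu₀_nondeg : ∀ u : W0C Ω n,
      (∀ φ : W012 Ω n, opA ahat (toW Ω n u) φ +
        pairD (fderiv ℝ (opF f p₀ hf) (toC Ω n u₀) (toC Ω n u)) φ = 0) → u = 0)
    -- the Banach spaces `U` and `V` with their embeddings `ι` and `κ`
    {U V : Type*} [NormedAddCommGroup U] [NormedSpace ℝ U] [CompleteSpace U]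
    [NormedAddCommGroup V] [NormedSpace ℝ V] [CompleteSpace V]
    (ι : U →L[ℝ] W0C Ω n) (hι : Function.Injective ι)
    (hι_cpt : IsCompactOperator (toC Ω n ∘L ι))
    (κ : V →L[ℝ] Wneg Ω n) (hκ : Function.Injective κ)
    -- the operators `Â`, `A_ε` and `D` as bounded operators into `V`
    (hAhat : ∃ B : U →L[ℝ] V, ∀ u, κ (B u) = opA ahat (toW Ω n (ι u)))
    (A : ℝ → U →L[ℝ] V) (hA : ∀ ε > 0, ∀ u, κ (A ε u) = opA (a ε) (toW Ω n (ι u)))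
    (D : LpGr Ω n p₀ →L[ℝ] V) (hD : ∀ g φ, κ (D g) φ = pairD g φ)
    (hA_bij : ∀ ε > 0, Function.Bijective (A ε))
    (hA_inv : ∃ C : ℝ, ∀ ε > 0, ‖(A ε).inverse‖ ≤ C) :
    ∃ ε₀ > 0,
      -- `A_ε + D F'(u₀)` has an inverse, so that `G_ε` is defined, bounded uniformly in `ε`
      (∀ ε ∈ Ioc 0 ε₀, Function.Bijective
        (linOp (A ε) D (fderiv ℝ (opF f p₀ hf) (toC Ω n u₀)) (toC Ω n ∘L ι))) ∧
      (∃ C : ℝ, ∀ ε ∈ Ioc 0 ε₀,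
        ‖(linOp (A ε) D (fderiv ℝ (opF f p₀ hf) (toC Ω n u₀)) (toC Ω n ∘L ι)).inverse‖ ≤ C) ∧
      ∃ r₀ > 0, ∃ ε₁ ∈ Ioc 0 ε₀, ∃ uε : ℝ → U,
        -- `uε ε` is the unique fixed point of `G_ε` in the closed ball of radius `r₀`
        (∀ ε ∈ Ioc 0 ε₁, ∀ u : U,
          (‖u - approxSol (A ε) D (opF f p₀ hf) (toC Ω n u₀)‖ ≤ r₀ ∧
            fixMap (A ε) D (opF f p₀ hf) (toC Ω n u₀) (toC Ω n ∘L ι) u = u) ↔ u = uε ε) ∧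
        -- the error estimate
        ((fun ε => supNorm (toC Ω n (ι (uε ε)) - toC Ω n u₀)) =O[𝓝[>] 0] fun ε =>
          supNorm (toC Ω n (ι (approxSol (A ε) D (opF f p₀ hf) (toC Ω n u₀))) - toC Ω n u₀) +
          ‖A ε (approxSol (A ε) D (opF f p₀ hf) (toC Ω n u₀)) +
            D (opF f p₀ hf (toC Ω n (ι (approxSol (A ε) D (opF f p₀ hf) (toC Ω n u₀)))))‖) ∧
        -- local uniqueness with respect to the maximum norm
        ∃ δ > 0, ∃ ε₂ ∈ Ioc 0 ε₁, ∀ ε ∈ Ioc 0 ε₂,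
          (∀ u : U, (supNorm (toC Ω n (ι u) - toC Ω n u₀) < δ ∧
            fixMap (A ε) D (opF f p₀ hf) (toC Ω n u₀) (toC Ω n ∘L ι) u = u) ↔ u = uε ε) ∧
          (∀ u : W0C Ω n, (supNorm (toC Ω n u - toC Ω n u₀) < δ ∧
            IsWeakSolution (a ε) f u) ↔ u = ι (uε ε)) :=
  mainTheorem2_general hΩ.isOpen hΩ.isBounded a ahat ha_bdd ha_leg
    (let ⟨_, hc, hleg⟩ := ha_leg; ha_H.gConverges hΩ.isBounded hc hleg) f p₀ hp₀ hf u₀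
    (hF.contDiffAt.hasStrictFDerivAt one_ne_zero) hu₀ hu₀_nondeg ι hι_cpt κ A hA D hD hA_bij hA_inv
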